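/- **Proposition 4.6.** For $m,k\in\mathbb{N}$ and $s\ge 0$ let $H^m(\mathbb{R})$ be the space of complex-valued functions in $L^2(\mathbb{R})$ with weak derivatives up to order $m$ in $L^2(\mathbb{R})$, and let $H^{k,s}(\mathbb{R})$ be the space of functions which, together with their weak derivatives up to order $k$, lie in $L^{2,s}(\mathbb{R})=\{f\in L^2(\mathbb{R}):\langle x\rangle^s f\in L^2(\mathbb{R})\}$, $\langle x\rangle=\sqrt{1+|x|^2}$. Let $q\in H^2(\mathbb{R})\cap H^{1,1}(\mathbb{R})$ and let $\lambda_1\in\mathbb{C}$ satisfy $\operatorname{Im}\lambda_1^2>0$ (the open first or third quadrant, which lies off the continuous spectrum $\mathbb{R}\cup i\mathbb{R}$). Consider the spectral problem $$\Phi_x=\Big(-i\lambda_1^2+\tfrac{i}{4}|q|^2\Big)\begin{pmatrix}1&0\\0&-1\end{pmatrix}\Phi+\lambda_1\begin{pmatrix}0&q\\-\bar q&0\end{pmatrix}\Phi,\qquad \Phi:\mathbb{R}\to\mathbb{C}^2 .$$ There is exactly one bounded function $\varphi_-=\varphi_-(\cdot;\lambda_1):\mathbb{R}\to\mathbb{C}^2$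 (the Jost function) such that $\varphi_-(x)\to(1,0)^T$ as $x\to-\infty$ and $\Phi_1(x)=\varphi_-(x)e^{-i\lambda_1^2x}$ is a locally absolutely continuous solution of the spectral problem. For $\lambda\in\mathbb{C}$ and $\Phi=(f,g)^T\in\mathbb{C}^2$ put $m_{\lambda}(\Phi,\Phi)=\lambda|f|^2+\bar\lambda|g|^2$. Then $m_{\lambda_1}(\Phi_1(x),\Phi_1(x))\neq0$ for every $x\in\mathbb{R}$, and, writing $\Phi_1=(f_1,g_1)^T$, the Darboux transform $$q^{(1)}=\frac{m_{\bar\lambda_1}(\Phi_1,\Phi_1)}{m_{\lambda_1}(\Phi_1,\Phi_1)}\,q-2i\,\frac{(\lambda_1^2-\bar\lambda_1^2)\,f_1\bar g_1}{m_{\lambda_1}(\Phi_1,\Phi_1)}$$ belongs to $H^2(\mathbb{R})\cap H^{1,1}(\mathbb{R})$. This holds without any condition on $\lambda_1$ beyond $\operatorname{Im}\lambda_1^2>0$, thus both when $\lambda_1$ is an eigenvalue of the spectral problem (vanishing scattering coefficient, $a(\lambda_1)=0$) and when it is not ($a(\lambda_1)\neq0$). -/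

import Mathlib

open MeasureTheory Filter Topology
open scoped ContDiff Matrix ComplexConjugate

/-! ### Weighted Sobolev spaces on the line -/

/-- `g` is the `j`-th weak derivative of `f` on the line. -/
def HasWeakDeriv (j : ℕ) (f g : ℝ → ℂ) : Prop :=
  LocallyIntegrable f ∧ LocallyIntegrable g ∧
    ∀ η : ℝ → ℝ, ContDiff ℝ ∞ η → HasCompactSupport η →
      ∫ x, iteratedDeriv j η x • f x = (-1 : ℝ) ^ j • ∫ x, η x • g x

/-- The bracket `⟨x⟩ = √(1 + |x|²)`. -/
noncomputable def japaneseBracket (x : ℝ) : ℝ := Real.sqrt (1 + |x| ^ 2)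

/-- `f ∈ L^{2,s}(ℝ)`: both `f` and `⟨x⟩^s f` are square integrable. -/
def MemL2Weighted (s : ℝ) (f : ℝ → ℂ) : Prop :=
  MemLp f 2 volume ∧ MemLp (fun x => (japaneseBracket x ^ s) • f x) 2 volume

/-- `f ∈ H^m(ℝ)`: `f` and its weak derivatives up to order `m` are square integrable. -/
def MemSobolevH (m : ℕ) (f : ℝ → ℂ) : Prop :=
  MemLp f 2 volume ∧
    ∀ j : ℕ, 1 ≤ j → j ≤ m → ∃ g : ℝ → ℂ, HasWeakDeriv j f g ∧ MemLp g 2 volume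

/-- `f ∈ H^{k,s}(ℝ)`: `f` and its weak derivatives up to order `k` lie in `L^{2,s}(ℝ)`. -/
def MemSobolevHWeighted (k : ℕ) (s : ℝ) (f : ℝ → ℂ) : Prop :=
  MemL2Weighted s f ∧
    ∀ j : ℕ, 1 ≤ j → j ≤ k → ∃ g : ℝ → ℂ, HasWeakDeriv j f g ∧ MemL2Weighted s g

/-! ### The spectral problem and its Jost solution -/

/-- The Pauli matrix `σ₃`. -/
def sigmaThree : Matrix (Fin 2) (Fin 2) ℂ := !![1, 0; 0, -1]

/-- The potential matrix `Q` under the reduction `r = conj q`. -/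
noncomputable def potentialMatrix (q : ℂ) : Matrix (Fin 2) (Fin 2) ℂ :=
  !![0, q; -conj q, 0]

/-- The coefficient matrix `U = (-iλ² + (i/4) q r) σ₃ + λ Q` with `r = conj q`. -/
noncomputable def laxU (lam q : ℂ) : Matrix (Fin 2) (Fin 2) ℂ :=
  (-Complex.I * lam ^ 2 + Complex.I / 4 * (q * conj q)) • sigmaThree +
    lam • potentialMatrix q

/-- `Φ` is an absolutely continuous solution of `Φ_x = U Φ`, written in integrated form so that
it depends only on the almost-everywhere class of `q`. -/
def SolvesSpectralProblem (q : ℝ → ℂ) (lam : ℂ) (Φ : ℝ → Fin 2 → ℂ) : Prop :=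
  Continuous Φ ∧ ∀ x y : ℝ, Φ y - Φ x = ∫ z in x..y, laxU lam (q z) *ᵥ Φ z

/-- The vector function `Φ₁(x) = φ(x) e^{-iλ²x}`. -/
noncomputable def seedSolution (lam : ℂ) (φ : ℝ → Fin 2 → ℂ) : ℝ → Fin 2 → ℂ :=
  fun x => Complex.exp (-Complex.I * lam ^ 2 * (x : ℂ)) • φ x

/-- `φ` is the Jost function `φ₋(·; λ)`: bounded, tending to `e₁` at `-∞`, and such that
`φ(x) e^{-iλ²x}` solves the spectral problem. -/
structure IsJostMinus (q : ℝ → ℂ) (lam : ℂ) (φ : ℝ → Fin 2 → ℂ) : Prop where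
  solves : SolvesSpectralProblem q lam (seedSolution lam φ)
  bounded : ∃ M : ℝ, ∀ x, ‖φ x‖ ≤ M
  tendsto_atBot : Tendsto φ atBot (𝓝 ![1, 0])

/-! ### The Darboux transformation -/

/-- `m_λ(f, g) = λ f₁ conj g₁ + conj λ f₂ conj g₂`. -/
noncomputable def mForm (lam : ℂ) (f g : Fin 2 → ℂ) : ℂ :=
  lam * f 0 * conj (g 0) + conj lam * f 1 * conj (g 1)

/-- `C_λ(Φ) = m_{conj λ}(Φ, Φ) / m_λ(Φ, Φ)`. -/
noncomputable def darbouxC (lam : ℂ) (Φ : Fin 2 → ℂ) : ℂ :=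
  mForm (conj lam) Φ Φ / mForm lam Φ Φ

/-- `D_λ(Φ) = (λ² - (conj λ)²) f₁ conj g₁ / m_λ(Φ, Φ)` for `Φ = (f₁, g₁)`. -/
noncomputable def darbouxD (lam : ℂ) (Φ : Fin 2 → ℂ) : ℂ :=
  (lam ^ 2 - conj lam ^ 2) * Φ 0 * conj (Φ 1) / mForm lam Φ Φ

/-- The transformed potential `B(Φ; λ) q = C_λ(Φ) q - 2i D_λ(Φ)`. -/
noncomputable def darbouxB (lam : ℂ) (Φ : ℝ → Fin 2 → ℂ) (q : ℝ → ℂ) : ℝ → ℂ :=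
  fun x => darbouxC lam (Φ x) * q x - 2 * Complex.I * darbouxD lam (Φ x)

/-! The Darboux transform depends on the seed $\Phi=(f,g)$ only through its direction in
$\mathbb{C}^2$. Put $N=|f|^2+|g|^2$, $P=(|f|^2-|g|^2)/N$ and $R=f\bar g/N$, so that $P$ is real and
$P^2+4|R|^2=1$. Then $m_\lambda(\Phi,\Phi)=N d$ with $d=\frac12(\lambda(1+P)+\bar\lambda(1-P))$, and
$\operatorname{Re} d=\operatorname{Re}\lambda\ne0$. Hence the denominator is bounded away from zero
after normalisation, and $q^{(1)}=((\lambda+\bar\lambda)/d-1)q-2i(\lambda^2-\bar\lambda^2)R/d$.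
Everything reduces to the decay and regularity of $R$.

Decay: along a nowhere vanishing solution $P'=8\operatorname{Im}(\lambda^2)|R|^2+E$ with $|E|\le
8|\lambda||q||R|$ (`rateP_eq`, `norm_rateE_le`). The first term has a fixed sign and $|P|\le1$, so
integrating and absorbing $E$ gives $R\in L^2$. Then $P\to\pm1$ at each end, with $|P\mp1|\le4|R|^2$
far out. Integrating $P'$ against a truncation of $x^2$ gives $xR\in L^2$
(`PolarFlow.integrable_mul_sq`). At $+\infty$ the limit is $1$ when $a(\lambda_1)\neq0$ and $-1$
when $a(\lambda_1)=0$; the estimate is indifferent to this sign, so no case distinction arises.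

Regularity: $R'=AR+Bq$ with bounded $C^1$ coefficients $A,B$, so $R'$ inherits the weight and lies
in $H^1$; the multipliers built from $1/d$ are smooth enough to preserve both spaces
(`SobolevRep.darbouxB`).

The Jost function is the fixed point of a Volterra equation, a contraction in an exponentially
weighted supremum norm (`exists_isJostMinus`). It is unique because the Wronskian of two candidates
is constant and vanishes at $-\infty$ (`IsJostMinus.unique`). -/

/-! ### Absolutely continuous primitives and weak derivatives -/

/-- `F` is a locally absolutely continuous function with almost everywhere derivative `g`. -/
def IsPrimitive (F g : ℝ → ℂ) : Prop :=
  LocallyIntegrable g ∧ ∀ x y : ℝ, F y - F x = ∫ z in x..y, g z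

theorem MeasureTheory.LocallyIntegrable.intervalIntegrable_real {g : ℝ → ℂ}
    (hg : LocallyIntegrable g) (a b : ℝ) : IntervalIntegrable g volume a b :=
  ((hg.integrableOn_isCompact isCompact_uIcc).intervalIntegrable)

/-- The real and imaginary parts are treated separately and recombined as multiples of the constants
$1$ and $i$. -/
theorem MeasureTheory.LocallyIntegrable.absolutelyContinuousOnInterval_integral
    {g : ℝ → ℂ} (hg : LocallyIntegrable g) (x y : ℝ) :
    AbsolutelyContinuousOnInterval (fun t => ∫ z in x..t, g z) x y := by
  have hre : IntervalIntegrable (fun t => (g t).re) volume x y :=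
    ⟨(hg.intervalIntegrable_real x y).1.re, (hg.intervalIntegrable_real x y).2.re⟩
  have him : IntervalIntegrable (fun t => (g t).im) volume x y :=
    ⟨(hg.intervalIntegrable_real x y).1.im, (hg.intervalIntegrable_real x y).2.im⟩
  have hc : ∀ c : ℂ, AbsolutelyContinuousOnInterval (fun _ : ℝ => c) x y := fun c =>
    (contDiff_const (n := 1)).contDiffOn.absolutelyContinuousOnInterval
  have h1 := (hre.absolutelyContinuousOnInterval_intervalIntegral
    (Set.left_mem_uIcc)).smul (hc 1)
  have h2 := (him.absolutelyContinuousOnInterval_intervalIntegral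
    (Set.left_mem_uIcc)).smul (hc Complex.I)
  convert! h1.add h2 using 1
  funext t
  have hi := hg.intervalIntegrable_real x t
  have e1 : ∫ z in x..t, (g z).re = (∫ z in x..t, g z).re :=
    Complex.reCLM.intervalIntegral_comp_comm hi
  have e2 : ∫ z in x..t, (g z).im = (∫ z in x..t, g z).im :=
    Complex.imCLM.intervalIntegral_comp_comm hi
  simp only [Pi.add_apply, Pi.smul_apply', e1, e2]
  apply Complex.ext <;> simp

namespace IsPrimitive

variable {F G g h a a' : ℝ → ℂ}

theorem eq_add (hF : IsPrimitive F g) (x y : ℝ) : F y = F x + ∫ z in x..y, g z := by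
  rw [← hF.2 x y]; ring

theorem continuous (hF : IsPrimitive F g) : Continuous F := by
  have : F = fun y => F 0 + ∫ z in (0 : ℝ)..y, g z := funext fun y => hF.eq_add 0 y
  rw [this]
  exact continuous_const.add
    (intervalIntegral.continuous_primitive (fun a b => hF.1.intervalIntegrable_real a b) 0)

theorem add (hF : IsPrimitive F g) (hG : IsPrimitive G h) :
    IsPrimitive (fun x => F x + G x) (fun x => g x + h x) := by
  refine ⟨hF.1.add hG.1, fun x y => ?_⟩
  rw [intervalIntegral.integral_add (hF.1.intervalIntegrable_real x y)
    (hG.1.intervalIntegrable_real x y), ← hF.2, ← hG.2]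
  ring

theorem of_hasDerivAt (ha : ∀ x, HasDerivAt a (a' x) x) (hc : Continuous a') :
    IsPrimitive a a' := by
  refine ⟨hc.locallyIntegrable, fun x y => ?_⟩
  rw [intervalIntegral.integral_eq_sub_of_hasDerivAt (fun t _ => ha t) (hc.intervalIntegrable _ _)]

theorem absolutelyContinuousOnInterval (hF : IsPrimitive F g) (x y : ℝ) :
    AbsolutelyContinuousOnInterval F x y := by
  have h1 := hF.1.absolutelyContinuousOnInterval_integral x y
  have h2 : AbsolutelyContinuousOnInterval (fun _ : ℝ => F x) x y :=
    (contDiff_const (n := 1)).contDiffOn.absolutelyContinuousOnInterval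
  convert! h2.add h1 using 1
  funext t
  exact hF.eq_add x t

/-- The product minus the integral of its expected derivative is absolutely continuous with
derivative zero almost everywhere, hence constant. One $C^1$ factor suffices, since products are
only needed with $C^1$ multipliers and test functions. -/
theorem mul (ha : ∀ x, HasDerivAt a (a' x) x) (hc : Continuous a') (hF : IsPrimitive F g) :
    IsPrimitive (fun x => a x * F x) (fun x => a' x * F x + a x * g x) := by
  have hac : Continuous a := continuous_iff_continuousAt.2 fun x => (ha x).continuousAt
  have hloc : LocallyIntegrable (fun x => a' x * F x + a x * g x) := by
    refine (hc.mul hF.continuous).locallyIntegrable.add ?_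
    have := (locallyIntegrableOn_univ.2 hF.1).continuousOn_smul (𝕜 := ℂ) (g := a)
      isOpen_univ.isLocallyClosed hac.continuousOn
    exact locallyIntegrableOn_univ.1 this
  refine ⟨hloc, fun x y => ?_⟩
  have hint := hloc.intervalIntegrable_real x y
  let D : ℝ → ℂ := fun t => a t * F t - ∫ z in x..t, (a' z * F z + a z * g z)
  have hD : AbsolutelyContinuousOnInterval D x y :=
    (((of_hasDerivAt ha hc).absolutelyContinuousOnInterval x y).smul
      (hF.absolutelyContinuousOnInterval x y)).sub
      (hloc.absolutelyContinuousOnInterval_integral x y)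
  have hD0 : ∀ᵐ t, t ∈ Set.uIcc x y → HasDerivAt D 0 t := by
    filter_upwards [(hF.1.intervalIntegrable_real x y).ae_hasDerivAt_integral,
      hint.ae_hasDerivAt_integral] with t h1 h2 ht
    have h3 : HasDerivAt F (g t) t := by
      have h4 := (h1 ht x (by simp)).const_add (F x)
      have h5 : F = fun y => F x + ∫ z in x..y, g z := funext fun y => hF.eq_add x y
      rwa [← h5] at h4
    have := ((ha t).mul h3).sub (h2 ht x (by simp))
    simpa [D] using! this
  obtain ⟨C, hC⟩ := hD.const_of_ae_hasDerivAt_zero hD0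
  have h1 := hC x (by simp)
  have h2 := hC y (by simp)
  simp only [D, intervalIntegral.integral_same] at h1 h2
  linear_combination h2 - h1

theorem integral_deriv_smul (hF : IsPrimitive F g) {η : ℝ → ℝ} (hη : ContDiff ℝ ∞ η)
    (hs : HasCompactSupport η) :
    ∫ x, deriv η x • F x = - ∫ x, η x • g x := by
  have hd : ∀ x, HasDerivAt (fun t => (η t : ℂ)) ((deriv η x : ℝ) : ℂ) x := fun x =>
    ((hη.differentiable (by simp)).differentiableAt.hasDerivAt).ofReal_comp
  have hc : Continuous (fun x => ((deriv η x : ℝ) : ℂ)) :=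
    Complex.continuous_ofReal.comp (hη.continuous_deriv (by simp))
  have hP := mul hd hc hF
  -- The interval of half-length $|M|+1$ contains the support strictly, so the boundary terms at
  -- both endpoints vanish.
  obtain ⟨M, hM⟩ := hs.isBounded.subset_closedBall (0 : ℝ)
  have hout : ∀ x, x ∉ Set.Ioc (-(|M| + 1)) (|M| + 1) → x ∉ tsupport η := by
    intro x hx hx'
    have := hM hx'
    rw [mem_closedBall_zero_iff, Real.norm_eq_abs] at this
    have h1 := abs_le.1 (this.trans (le_abs_self M))
    exact hx ⟨by linarith [h1.1], by linarith [h1.2]⟩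
  have hz : ∀ x, x ∉ tsupport η → η x = 0 := fun x hx => image_eq_zero_of_notMem_tsupport hx
  have hz' : ∀ x, x ∉ tsupport η → deriv η x = 0 := fun x hx =>
    image_eq_zero_of_notMem_tsupport fun h => hx (tsupport_deriv_subset h)
  have hI1 : Integrable (fun x => deriv η x • F x) :=
    ((hη.continuous_deriv (by simp)).smul hF.continuous).integrable_of_hasCompactSupport
      (hs.deriv.smul_right)
  have hI2 : Integrable (fun x => η x • g x) :=
    hF.1.integrable_smul_left_of_hasCompactSupport hη.continuous hs
  have h1 := hP.2 (-(|M| + 1)) (|M| + 1)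
  have hle : -(|M| + 1) ≤ |M| + 1 := by have := abs_nonneg M; linarith
  rw [intervalIntegral.integral_of_le hle, setIntegral_eq_integral_of_forall_compl_eq_zero] at h1
  · have e1 : η (|M| + 1) = 0 := hz _ fun h => by
      have := hM h
      rw [mem_closedBall_zero_iff, Real.norm_eq_abs, abs_of_nonneg (by positivity)] at this
      linarith [le_abs_self M]
    have e2 : η (-(|M| + 1)) = 0 := hz _ (hout _ (by simp))
    beta_reduce at h1
    rw [e1, e2] at h1
    have h2 : ∫ x, (deriv η x • F x + η x • g x) = 0 := by
      simpa [Complex.real_smul] using h1.symm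
    rw [integral_add hI1 hI2] at h2
    exact eq_neg_of_add_eq_zero_left h2
  · intro x hx
    simp [hz x (hout x hx), hz' x (hout x hx)]

theorem hasWeakDeriv_one (hF : IsPrimitive F g) : HasWeakDeriv 1 F g := by
  refine ⟨hF.continuous.locallyIntegrable, hF.1, fun η hη hs => ?_⟩
  simpa using hF.integral_deriv_smul hη hs

theorem hasWeakDeriv_two (hF : IsPrimitive F g) (hg : IsPrimitive g h) : HasWeakDeriv 2 F h := by
  refine ⟨hF.continuous.locallyIntegrable, hg.1, fun η hη hs => ?_⟩
  have hη' : ContDiff ℝ ∞ (deriv η) := (contDiff_infty_iff_deriv.1 hη).2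
  have h1 := hF.integral_deriv_smul hη' hs.deriv
  have h2 := hg.integral_deriv_smul hη hs
  rw [iteratedDeriv_succ, iteratedDeriv_one, h1, h2]
  simp

end IsPrimitive

/-- A locally integrable function with vanishing weak derivative is almost everywhere constant. -/
theorem ae_eq_const_of_integral_deriv_smul_eq_zero {f : ℝ → ℂ} (hf : LocallyIntegrable f)
    (h : ∀ η : ℝ → ℝ, ContDiff ℝ ∞ η → HasCompactSupport η → ∫ x, deriv η x • f x = 0) :
    ∃ c : ℂ, f =ᵐ[volume] fun _ => c := by
  obtain ⟨b⟩ : Nonempty (ContDiffBump (0 : ℝ)) := inferInstance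
  let ρ : ℝ → ℝ := b.normed volume
  have hρ : ContDiff ℝ ∞ ρ := b.contDiff_normed
  have hρs : HasCompactSupport ρ := b.hasCompactSupport_normed
  have hρ1 : ∫ x, ρ x = 1 := b.integral_normed
  refine ⟨∫ x, ρ x • f x, ae_eq_of_integral_contDiff_smul_eq hf
    (locallyIntegrable_const _) fun ψ hψ hψs => ?_⟩
  -- Removing a multiple of a bump of integral one leaves a test function of mean zero. Its
  -- primitive $\eta$ is again compactly supported, and testing $f$ against $\eta'=k$ gives
  -- $\int\psi f=(\int\psi)(\int\rho f)$.
  let k : ℝ → ℝ := fun x => ψ x - (∫ t, ψ t) * ρ x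
  have hk : ContDiff ℝ ∞ k := hψ.sub (contDiff_const.mul hρ)
  have hks : HasCompactSupport k := hψs.sub (hρs.mul_left)
  have hψi : Integrable ψ := hψ.continuous.integrable_of_hasCompactSupport hψs
  have hρi : Integrable ρ := hρ.continuous.integrable_of_hasCompactSupport hρs
  have hki : ∫ x, k x = 0 := by
    rw [integral_sub hψi (hρi.const_mul _), integral_const_mul, hρ1]; ring
  have hkint : Integrable k := hk.continuous.integrable_of_hasCompactSupport hks
  obtain ⟨M, hM⟩ := hks.isBounded.subset_closedBall (0 : ℝ)
  have hz : ∀ x, |M| < |x| → k x = 0 := fun x hx => image_eq_zero_of_notMem_tsupport fun h' => by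
    have := hM h'
    rw [mem_closedBall_zero_iff, Real.norm_eq_abs] at this
    linarith [le_abs_self M]
  let η : ℝ → ℝ := fun x => ∫ t in (-(|M| + 1))..x, k t
  have hηd : ∀ x, HasDerivAt η (k x) x := fun x =>
    intervalIntegral.integral_hasDerivAt_right (hk.continuous.intervalIntegrable _ _)
      (hk.continuous.stronglyMeasurableAtFilter _ _) hk.continuous.continuousAt
  have hηd' : deriv η = k := funext fun x => (hηd x).deriv
  have hη : ContDiff ℝ ∞ η :=
    contDiff_infty_iff_deriv.2 ⟨fun x => (hηd x).differentiableAt, hηd' ▸ hk⟩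
  have hηs : HasCompactSupport η := by
    refine HasCompactSupport.intro (isCompact_Icc (a := -(|M| + 1)) (b := |M| + 1)) fun x hx => ?_
    have hM0 := abs_nonneg M
    have key : ∀ u v : ℝ, u ≤ v → (∀ t ∈ Set.uIcc u v, |M| < |t|) → ∫ t in u..v, k t = 0 := by
      intro u v _ huv
      rw [intervalIntegral.integral_congr (g := fun _ => 0) fun t ht => hz t (huv t ht)]
      simp
    rw [Set.mem_Icc, not_and_or, not_le, not_le] at hx
    rcases hx with hx | hx
    · simp only [η]
      rw [intervalIntegral.integral_symm, key _ _ hx.le, neg_zero]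
      intro t ht
      rw [Set.uIcc_of_le hx.le] at ht
      exact lt_abs.2 (Or.inr (by linarith [ht.2]))
    · have h1 : ∫ t in (-(|M| + 1))..(|M| + 1), k t = 0 := by
        rw [intervalIntegral.integral_of_le (by linarith),
          setIntegral_eq_integral_of_forall_compl_eq_zero, hki]
        intro t ht
        apply hz
        rw [Set.mem_Ioc, not_and_or, not_lt, not_le] at ht
        rcases ht with ht | ht
        · exact lt_abs.2 (Or.inr (by linarith))
        · exact lt_abs.2 (Or.inl (by linarith))
      simp only [η]
      rw [← intervalIntegral.integral_add_adjacent_intervals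
        (hk.continuous.intervalIntegrable _ (|M| + 1)) (hk.continuous.intervalIntegrable _ _), h1,
        key _ _ hx.le, add_zero]
      intro t ht
      rw [Set.uIcc_of_le hx.le] at ht
      exact lt_abs.2 (Or.inl (by linarith [ht.1]))
  have h0 := h η hη hηs
  rw [hηd'] at h0
  have hf1 : Integrable (fun x => ψ x • f x) :=
    hf.integrable_smul_left_of_hasCompactSupport hψ.continuous hψs
  have hf2 : Integrable (fun x => ρ x • f x) :=
    hf.integrable_smul_left_of_hasCompactSupport hρ.continuous hρs
  have : ∫ x, k x • f x = (∫ x, ψ x • f x) - (∫ t, ψ t) • ∫ x, ρ x • f x := by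
    rw [← integral_smul, ← integral_sub hf1 (hf2.fun_smul _)]
    refine integral_congr_ae (ae_of_all _ fun x => ?_)
    simp only [k, sub_smul, mul_smul]
  rw [this, sub_eq_zero] at h0
  rw [h0, integral_smul_const]

/-- The difference between $f$ and an indefinite integral of $g$ has weak derivative zero, so it is
almost everywhere constant. -/
theorem HasWeakDeriv.exists_isPrimitive {f g : ℝ → ℂ} (h : HasWeakDeriv 1 f g) :
    ∃ F, IsPrimitive F g ∧ f =ᵐ[volume] F := by
  obtain ⟨hf, hg, h⟩ := h
  let G : ℝ → ℂ := fun x => ∫ t in (0 : ℝ)..x, g t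
  have hG : IsPrimitive G g := ⟨hg, fun x y => by
    simp only [G]
    rw [intervalIntegral.integral_interval_sub_left (hg.intervalIntegrable_real _ _)
      (hg.intervalIntegrable_real _ _)]⟩
  obtain ⟨c, hc⟩ := ae_eq_const_of_integral_deriv_smul_eq_zero
    (hf.sub hG.continuous.locallyIntegrable) fun η hη hs => by
      have h1 := h η hη hs
      have h2 := hG.integral_deriv_smul hη hs
      have hη' : Continuous (deriv η) := hη.continuous_deriv (by simp)
      simp only [iteratedDeriv_one, pow_one, neg_smul, one_smul] at h1
      simp only [Pi.sub_apply, smul_sub]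
      rw [integral_sub (hf.integrable_smul_left_of_hasCompactSupport hη' hs.deriv)
        (hG.continuous.locallyIntegrable.integrable_smul_left_of_hasCompactSupport hη' hs.deriv),
        h1, h2, sub_self]
  refine ⟨fun x => G x + c, ⟨hg, fun x y => ?_⟩, ?_⟩
  · rw [← hG.2 x y]; ring
  · filter_upwards [hc] with x hx
    rw [Pi.sub_apply] at hx
    rw [← hx]; ring

theorem HasWeakDeriv.congr_ae {j : ℕ} {f f' g g' : ℝ → ℂ} (h : HasWeakDeriv j f g)
    (hf : f =ᵐ[volume] f') (hg : g =ᵐ[volume] g') : HasWeakDeriv j f' g' := by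
  refine ⟨fun x => ?_, fun x => ?_, fun η hη hs => ?_⟩
  · exact (h.1 x).congr hf
  · exact (h.2.1 x).congr hg
  · rw [← integral_congr_ae (f := fun x => iteratedDeriv j η x • f x)
        (g := fun x => iteratedDeriv j η x • f' x)
        (hf.mono fun x hx => by simp only [hx]),
      ← integral_congr_ae (f := fun x => η x • g x) (g := fun x => η x • g' x)
        (hg.mono fun x hx => by simp only [hx])]
    exact h.2.2 η hη hs

theorem HasWeakDeriv.unique {j : ℕ} {f g g' : ℝ → ℂ} (h : HasWeakDeriv j f g)
    (h' : HasWeakDeriv j f g') : g =ᵐ[volume] g' := by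
  refine ae_eq_of_integral_contDiff_smul_eq h.2.1 h'.2.1 fun η hη hs => ?_
  have := (h.2.2 η hη hs).symm.trans (h'.2.2 η hη hs)
  exact (smul_right_injective ℂ (pow_ne_zero j (by norm_num : (-1 : ℝ) ≠ 0))) this

/-- Test the first-order identity against $\eta'$. This is needed because $H^2$ is defined by the
weak derivatives of $f$ of each order separately. -/
theorem HasWeakDeriv.of_one_two {f g h : ℝ → ℂ} (h1 : HasWeakDeriv 1 f g)
    (h2 : HasWeakDeriv 2 f h) : HasWeakDeriv 1 g h := by
  refine ⟨h1.2.1, h2.2.1, fun η hη hs => ?_⟩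
  have e1 := h1.2.2 _ (contDiff_infty_iff_deriv.1 hη).2 hs.deriv
  have e2 := h2.2.2 η hη hs
  rw [iteratedDeriv_succ, iteratedDeriv_one] at e2
  simp only [iteratedDeriv_one, pow_one, neg_smul, one_smul] at e1 ⊢
  rw [e2] at e1
  simp only [even_two, Even.neg_pow, one_pow, one_smul] at e1
  rw [e1, neg_neg]

/-- A function in `H¹(ℝ)` is bounded. -/
theorem IsPrimitive.bounded {F g : ℝ → ℂ} (hF : IsPrimitive F g) (hF2 : MemLp F 2 volume)
    (hg2 : MemLp g 2 volume) : ∃ M, ∀ x, ‖F x‖ ≤ M := by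
  have iF : Integrable (fun x => ‖F x‖ ^ 2) := hF2.integrable_norm_pow (by norm_num)
  have ig : Integrable (fun x => ‖g x‖ ^ 2) := hg2.integrable_norm_pow (by norm_num)
  -- $|F(x)|\le|F(t)|+\int_x^{x+1}|g|$ is averaged over $t\in[x,x+1]$. Each of the two $L^1$ norms
  -- on the unit interval is at most $1$ plus the squared $L^2$ norm, whence the $2$.
  refine ⟨2 + (∫ x, ‖F x‖ ^ 2) + ∫ x, ‖g x‖ ^ 2, fun x => ?_⟩
  have hx : x ≤ x + 1 := by linarith
  have bd : ∀ {k : ℝ → ℂ}, LocallyIntegrable k → Integrable (fun x => ‖k x‖ ^ 2) →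
      ∫ t in x..(x + 1), ‖k t‖ ≤ 1 + ∫ t, ‖k t‖ ^ 2 := by
    intro k hk hk2
    calc ∫ t in x..(x + 1), ‖k t‖ ≤ ∫ t in x..(x + 1), (1 + ‖k t‖ ^ 2) := by
          refine intervalIntegral.integral_mono_on hx (hk.intervalIntegrable_real _ _).norm
            (intervalIntegrable_const.add hk2.intervalIntegrable) fun t _ => ?_
          nlinarith [sq_nonneg (‖k t‖ - 1)]
      _ = 1 + ∫ t in x..(x + 1), ‖k t‖ ^ 2 := by
          rw [intervalIntegral.integral_add intervalIntegrable_const hk2.intervalIntegrable]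
          simp
      _ ≤ _ := by
          rw [intervalIntegral.integral_of_le hx]
          gcongr 1 + ?_
          exact setIntegral_le_integral hk2 (ae_of_all _ fun t => by positivity)
  have key : ∀ t ∈ Set.Icc x (x + 1), ‖F x‖ ≤ ‖F t‖ + ∫ s in x..(x + 1), ‖g s‖ := by
    intro t ht
    have h1 : F x = F t - ∫ s in x..t, g s := by rw [← hF.2]; ring
    have h2 : ‖∫ s in x..t, g s‖ ≤ ∫ s in x..t, ‖g s‖ :=
      intervalIntegral.norm_integral_le_integral_norm ht.1
    have h3 : ∫ s in x..t, ‖g s‖ ≤ ∫ s in x..(x + 1), ‖g s‖ :=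
      intervalIntegral.integral_mono_interval le_rfl ht.1 ht.2
        (ae_of_all _ fun s => norm_nonneg _) (hF.1.intervalIntegrable_real _ _).norm
    rw [h1]
    exact (norm_sub_le _ _).trans (by linarith)
  have h := intervalIntegral.integral_mono_on (μ := volume) hx intervalIntegrable_const
    ((hF.continuous.norm.intervalIntegrable _ _).add intervalIntegrable_const) key
  rw [intervalIntegral.integral_add (hF.continuous.norm.intervalIntegrable _ _)
    intervalIntegrable_const] at h
  simp only [intervalIntegral.integral_const, add_sub_cancel_left, one_smul] at h
  linarith [bd hF.continuous.locallyIntegrable iF, bd hF.1 ig]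

/-! ### The weighted space $L^{2,1}$ -/

theorem japaneseBracket_sq (x : ℝ) : japaneseBracket x ^ 2 = 1 + x ^ 2 := by
  rw [japaneseBracket, Real.sq_sqrt (by positivity), sq_abs]

theorem continuous_japaneseBracket : Continuous japaneseBracket := by
  unfold japaneseBracket; fun_prop

theorem memL2Weighted_one_iff {f : ℝ → ℂ} : MemL2Weighted 1 f ↔
    AEStronglyMeasurable f volume ∧ Integrable fun x => (1 + x ^ 2) * ‖f x‖ ^ 2 := by
  have hn : ∀ x, ‖(japaneseBracket x ^ (1 : ℝ)) • f x‖ ^ 2 = (1 + x ^ 2) * ‖f x‖ ^ 2 := fun x => by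
    rw [Real.rpow_one, norm_smul, mul_pow, Real.norm_eq_abs, sq_abs, japaneseBracket_sq]
  constructor
  · rintro ⟨h0, h1⟩
    refine ⟨h0.1, ?_⟩
    simpa only [hn] using h1.integrable_norm_pow (p := 2) (by norm_num)
  · rintro ⟨hm, hi⟩
    have hm' : AEStronglyMeasurable (fun x => (japaneseBracket x ^ (1 : ℝ)) • f x) volume := by
      simp only [Real.rpow_one]
      exact continuous_japaneseBracket.aestronglyMeasurable.smul hm
    refine ⟨(memLp_two_iff_integrable_sq_norm hm).2 (hi.mono' (hm.norm.pow 2) ?_),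
      (memLp_two_iff_integrable_sq_norm hm').2 (by simpa only [hn] using hi)⟩
    refine ae_of_all _ fun x => ?_
    rw [Real.norm_of_nonneg (by positivity)]
    nlinarith [mul_nonneg (sq_nonneg x) (sq_nonneg ‖f x‖)]

namespace MemL2Weighted

variable {f g : ℝ → ℂ}

theorem mono (hg : MemL2Weighted 1 g) (hf : AEStronglyMeasurable f volume) {M : ℝ}
    (h : ∀ x, ‖f x‖ ≤ M * ‖g x‖) : MemL2Weighted 1 f := by
  rw [memL2Weighted_one_iff] at hg ⊢
  refine ⟨hf, (hg.2.const_mul (M ^ 2)).mono' ?_ (ae_of_all _ fun x => ?_)⟩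
  · exact Continuous.aestronglyMeasurable (by fun_prop) |>.mul (hf.norm.pow 2)
  · rw [Real.norm_of_nonneg (by positivity)]
    have := pow_le_pow_left₀ (norm_nonneg _) (h x) 2
    rw [mul_pow] at this
    nlinarith [sq_nonneg x]

theorem bounded_mul (hf : MemL2Weighted 1 f) {a : ℝ → ℂ} (ha : Continuous a)
    (hb : ∃ M, ∀ x, ‖a x‖ ≤ M) : MemL2Weighted 1 fun x => a x * f x := by
  obtain ⟨M, hM⟩ := hb
  refine hf.mono (ha.aestronglyMeasurable.mul hf.1.1) (M := M) fun x => ?_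
  rw [norm_mul]
  exact mul_le_mul_of_nonneg_right (hM x) (norm_nonneg _)

theorem add (hf : MemL2Weighted 1 f) (hg : MemL2Weighted 1 g) :
    MemL2Weighted 1 fun x => f x + g x :=
  ⟨hf.1.add hg.1, by simpa only [smul_add] using! hf.2.add hg.2⟩

theorem congr_ae {s : ℝ} (hf : MemL2Weighted s f) (h : f =ᵐ[volume] g) : MemL2Weighted s g :=
  ⟨hf.1.ae_eq h, hf.2.ae_eq (h.mono fun x hx => by simp only [hx])⟩

/-- Arithmetic-geometric mean: $2|f|\le(1+x^2)|f|^2+(1+x^2)^{-1}$. -/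
theorem integrable (hf : MemL2Weighted 1 f) : Integrable f := by
  have hi := (memL2Weighted_one_iff.1 hf).2
  refine (integrable_inv_one_add_sq.add hi).mono' hf.1.1 (ae_of_all _ fun x => ?_)
  have h : 0 < 1 + x ^ 2 := by positivity
  have h1 : (1 + x ^ 2)⁻¹ * (1 + x ^ 2) = 1 := inv_mul_cancel₀ h.ne'
  have h2 : 0 < (1 + x ^ 2)⁻¹ := inv_pos.2 h
  simp only [Pi.add_apply]
  have h3 : (1 + x ^ 2)⁻¹ * ((1 + x ^ 2) * ‖f x‖ - 1) ^ 2 =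
      (1 + x ^ 2) * ‖f x‖ ^ 2 - 2 * ‖f x‖ + (1 + x ^ 2)⁻¹ := by
    field_simp; ring
  have h4 : 0 ≤ (1 + x ^ 2)⁻¹ * ((1 + x ^ 2) * ‖f x‖ - 1) ^ 2 := by positivity
  linarith [norm_nonneg (f x)]

theorem integrable_sq (hf : MemL2Weighted 1 f) : Integrable fun x => ‖f x‖ ^ 2 :=
  hf.1.integrable_norm_pow (p := 2) (by norm_num)

theorem integrable_mul_sq (hf : MemL2Weighted 1 f) : Integrable fun x => x ^ 2 * ‖f x‖ ^ 2 := by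
  refine ((memL2Weighted_one_iff.1 hf).2.sub hf.integrable_sq).congr (ae_of_all _ fun x => ?_)
  simp only [Pi.sub_apply]; ring

end MemL2Weighted

/-! ### $C^1$ representatives of functions in $H^2\cap H^{1,1}$ -/

/-- `u` is a `C¹` function with derivative `u₁`, whose derivative is absolutely continuous with
derivative `u₂`, and which lies in `H²(ℝ) ∩ H^{1,1}(ℝ)`. -/
structure SobolevRep (u u₁ u₂ : ℝ → ℂ) : Prop where
  hasDerivAt : ∀ x, HasDerivAt u (u₁ x) x
  prim : IsPrimitive u₁ u₂
  weighted : MemL2Weighted 1 u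
  weighted_deriv : MemL2Weighted 1 u₁
  memLp : MemLp u₂ 2 volume

namespace SobolevRep

variable {q u u₁ u₂ : ℝ → ℂ}

theorem isPrimitive (h : SobolevRep u u₁ u₂) : IsPrimitive u u₁ :=
  IsPrimitive.of_hasDerivAt h.hasDerivAt h.prim.continuous

theorem bounded (h : SobolevRep u u₁ u₂) : ∃ M, ∀ x, ‖u x‖ ≤ M :=
  h.isPrimitive.bounded h.weighted.1 h.weighted_deriv.1

theorem bounded_deriv (h : SobolevRep u u₁ u₂) : ∃ M, ∀ x, ‖u₁ x‖ ≤ M :=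
  h.prim.bounded h.weighted_deriv.1 h.memLp

theorem memSobolevH (h : SobolevRep u u₁ u₂) (hq : u =ᵐ[volume] q) : MemSobolevH 2 q := by
  refine ⟨h.weighted.1.ae_eq hq, fun j hj hj' => ?_⟩
  obtain rfl | rfl : j = 1 ∨ j = 2 := by omega
  · exact ⟨u₁, h.isPrimitive.hasWeakDeriv_one.congr_ae hq (ae_eq_refl _), h.weighted_deriv.1⟩
  · exact ⟨u₂, (h.isPrimitive.hasWeakDeriv_two h.prim).congr_ae hq (ae_eq_refl _), h.memLp⟩

theorem memSobolevHWeighted (h : SobolevRep u u₁ u₂) (hq : u =ᵐ[volume] q) :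
    MemSobolevHWeighted 1 1 q := by
  refine ⟨h.weighted.congr_ae hq, fun j hj hj' => ?_⟩
  obtain rfl : j = 1 := by omega
  exact ⟨u₁, h.isPrimitive.hasWeakDeriv_one.congr_ae hq (ae_eq_refl _), h.weighted_deriv⟩

end SobolevRep

theorem IsPrimitive.hasDerivAt {F g : ℝ → ℂ} (h : IsPrimitive F g) (hg : Continuous g) (x : ℝ) :
    HasDerivAt F (g x) x := by
  have h1 : F = fun y => F 0 + ∫ z in (0 : ℝ)..y, g z := funext fun y => h.eq_add 0 y
  rw [h1]
  exact (intervalIntegral.integral_hasDerivAt_right (hg.intervalIntegrable _ _)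
      (hg.stronglyMeasurableAtFilter _ _) hg.continuousAt).const_add _

/-- The second weak derivative is integrated twice. The first derivatives supplied by $H^2$ and by
$H^{1,1}$ are a priori different functions; uniqueness of weak derivatives identifies them, so a
single $u_1$ carries both the weight and the second derivative. -/
theorem MemSobolevH.exists_sobolevRep {q : ℝ → ℂ} (hq2 : MemSobolevH 2 q)
    (hq11 : MemSobolevHWeighted 1 1 q) :
    ∃ u u₁ u₂, SobolevRep u u₁ u₂ ∧ q =ᵐ[volume] u := by
  obtain ⟨g₁, h1, -⟩ := hq2.2 1 le_rfl (by norm_num)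
  obtain ⟨g₂, h2, hg2⟩ := hq2.2 2 (by norm_num) le_rfl
  obtain ⟨k₁, h3, hk⟩ := hq11.2 1 le_rfl le_rfl
  obtain ⟨u₁, hu1, hgu⟩ := (h1.of_one_two h2).exists_isPrimitive
  have hq' : HasWeakDeriv 1 q u₁ := h1.congr_ae (ae_eq_refl _) hgu
  obtain ⟨u, hu, hqu⟩ := hq'.exists_isPrimitive
  exact ⟨u, u₁, g₂, ⟨hu.hasDerivAt hu1.continuous, hu1, hq11.1.congr_ae hqu,
    hk.congr_ae (h3.unique hq'), hg2⟩, hqu⟩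

/-! ### The perturbed polar flow and its weighted decay -/

/-- The scalar data of a unit vector driven towards a pole: `p` is its height, `2 r` its distance
from the axis, and `b` controls the perturbation `e`. -/
structure PolarFlow (c K : ℝ) (p r e b : ℝ → ℝ) : Prop where
  c_pos : 0 < c
  r_nonneg : ∀ x, 0 ≤ r x
  hasDerivAt : ∀ x, HasDerivAt p (c * r x ^ 2 + e x) x
  unit : ∀ x, p x ^ 2 + 4 * r x ^ 2 = 1
  bound : ∀ x, |e x| ≤ K * (b x * r x)
  continuous_r : Continuous r
  continuous_e : Continuous e
  integrable_b : Integrable fun x => b x ^ 2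
  integrable_xb : Integrable fun x => x ^ 2 * b x ^ 2

namespace PolarFlow

variable {c K : ℝ} {p r e b : ℝ → ℝ}

/-- Young's inequality, balanced so that the perturbation costs only half of the driving term
$cr^2$. -/
theorem bound_sq (h : PolarFlow c K p r e b) (x : ℝ) :
    |e x| ≤ c / 2 * r x ^ 2 + K ^ 2 / (2 * c) * b x ^ 2 := by
  have hc := h.c_pos
  refine (h.bound x).trans ?_
  have : c / 2 * r x ^ 2 + K ^ 2 / (2 * c) * b x ^ 2 - K * (b x * r x) =
      (c * r x - K * b x) ^ 2 / (2 * c) := by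
    field_simp; ring
  have h2 : 0 ≤ (c * r x - K * b x) ^ 2 / (2 * c) := by positivity
  linarith

theorem le_deriv (h : PolarFlow c K p r e b) (x : ℝ) :
    c / 2 * r x ^ 2 - K ^ 2 / (2 * c) * b x ^ 2 ≤ c * r x ^ 2 + e x := by
  have := (abs_le.1 (h.bound_sq x)).1
  linarith

theorem abs_le_one (h : PolarFlow c K p r e b) (x : ℝ) : |p x| ≤ 1 :=
  abs_le_one_iff_mul_self_le_one.2 (by nlinarith [h.unit x, sq_nonneg (r x)])

theorem continuous_deriv (h : PolarFlow c K p r e b) :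
    Continuous fun x => c * r x ^ 2 + e x :=
  ((h.continuous_r.pow 2).const_smul c).add h.continuous_e

theorem integral_deriv (h : PolarFlow c K p r e b) (x y : ℝ) :
    ∫ t in x..y, (c * r t ^ 2 + e t) = p y - p x :=
  intervalIntegral.integral_eq_sub_of_hasDerivAt (fun t _ => h.hasDerivAt t)
    (h.continuous_deriv.intervalIntegrable _ _)

theorem intervalIntegral_le_integral {f : ℝ → ℝ} (hf : Integrable f) (h0 : ∀ x, 0 ≤ f x) {x y : ℝ}
    (hxy : x ≤ y) : ∫ t in x..y, f t ≤ ∫ t, f t := by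
  rw [intervalIntegral.integral_of_le hxy]
  exact setIntegral_le_integral hf (ae_of_all _ h0)

/-- On $[-n,n]$ the integral of $p'$ is at most $2$ because $|p|\le1$, while $p'\ge\frac
c2r^2-\frac{K^2}{2c}b^2$. -/
theorem integrable_r (h : PolarFlow c K p r e b) : Integrable fun x => r x ^ 2 := by
  have hc := h.c_pos
  have hr2 : Continuous fun x => r x ^ 2 := h.continuous_r.pow 2
  refine integrable_of_intervalIntegral_norm_bounded (l := atTop) (a := fun n : ℝ => -n)
    (b := fun n => n) (2 / c * (2 + K ^ 2 / (2 * c) * ∫ x, b x ^ 2))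
    (fun n => (hr2.integrableOn_Icc).mono_set Set.Ioc_subset_Icc_self)
    tendsto_neg_atTop_atBot tendsto_id ?_
  filter_upwards [eventually_ge_atTop 0] with n hn
  have hn' : -n ≤ n := by linarith
  have h1 : ∫ x in (-n)..n, (c / 2 * r x ^ 2 - K ^ 2 / (2 * c) * b x ^ 2) ≤ 2 := by
    calc _ ≤ ∫ x in (-n)..n, (c * r x ^ 2 + e x) :=
          intervalIntegral.integral_mono_on hn'
            ((hr2.intervalIntegrable _ _).const_mul _ |>.sub
              ((h.integrable_b.const_mul _).intervalIntegrable))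
            (h.continuous_deriv.intervalIntegrable _ _) fun x _ => h.le_deriv x
      _ = p n - p (-n) := h.integral_deriv _ _
      _ ≤ 2 := by linarith [(abs_le.1 (h.abs_le_one n)).2, (abs_le.1 (h.abs_le_one (-n))).1]
  rw [intervalIntegral.integral_sub ((hr2.intervalIntegrable _ _).const_mul _)
    ((h.integrable_b.const_mul _).intervalIntegrable), intervalIntegral.integral_const_mul,
    intervalIntegral.integral_const_mul] at h1
  have h2 := intervalIntegral_le_integral h.integrable_b (fun x => sq_nonneg _) hn'
  have h3 : K ^ 2 / (2 * c) * ∫ x in (-n)..n, b x ^ 2 ≤ K ^ 2 / (2 * c) * ∫ x, b x ^ 2 := by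
    gcongr
  simp only [norm_pow, Real.norm_eq_abs, sq_abs]
  rw [div_mul_eq_mul_div, le_div_iff₀ hc]
  linarith

theorem integrable_deriv (h : PolarFlow c K p r e b) :
    Integrable fun x => c * r x ^ 2 + e x := by
  refine (h.integrable_r.const_mul c).add ?_
  exact ((h.integrable_r.const_mul _).add (h.integrable_b.const_mul _)).mono'
    h.continuous_e.aestronglyMeasurable (ae_of_all _ h.bound_sq)

/-- Since $p'$ is integrable, $p$ has a limit. Both $1-p^2=4r^2$ and its derivative are integrable,
so $1-p^2\to0$ and the limit is a pole, of either sign. -/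
theorem exists_tendsto (h : PolarFlow c K p r e b) :
    ∃ l : ℝ, l ^ 2 = 1 ∧ Tendsto p atTop (𝓝 l) := by
  have hp := tendsto_limUnder_of_hasDerivAt_of_integrableOn_Ioi (a := 0)
    (fun x _ => h.hasDerivAt x) h.integrable_deriv.integrableOn
  refine ⟨_, ?_, hp⟩
  have hpc : Continuous p := continuous_iff_continuousAt.2 fun x => (h.hasDerivAt x).continuousAt
  have h1 : ∀ x, HasDerivAt (fun t => 1 - p t ^ 2) (-(2 * p x) * (c * r x ^ 2 + e x)) x := by
    intro x
    convert! ((h.hasDerivAt x).pow 2).const_sub 1 using 1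
    simp
  have h2 : Integrable fun x => -(2 * p x) * (c * r x ^ 2 + e x) := by
    refine h.integrable_deriv.bdd_mul (c := 2) (by fun_prop) (ae_of_all _ fun x => ?_)
    rw [norm_neg, norm_mul, Real.norm_eq_abs, Real.norm_eq_abs, abs_two]
    linarith [h.abs_le_one x]
  have h3 : Integrable fun x => 1 - p x ^ 2 :=
    (h.integrable_r.const_mul 4).congr (ae_of_all _ fun x => by
      have := h.unit x
      simp only; linarith)
  have h4 := tendsto_zero_of_hasDerivAt_of_integrableOn_Ioi (a := 0) (fun x _ => h1 x)
    h2.integrableOn h3.integrableOn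
  have h5 := tendsto_nhds_unique h4 ((hp.pow 2).const_sub 1)
  linarith

theorem weight_hasDerivAt {ε : ℝ} (hε : 0 < ε) (x : ℝ) :
    HasDerivAt (fun t => t ^ 2 / (1 + ε * t ^ 2)) (2 * x / (1 + ε * x ^ 2) ^ 2) x := by
  have hD : (1 + ε * x ^ 2) ≠ 0 := by positivity
  convert! ((hasDerivAt_id x).pow 2).div
    ((((hasDerivAt_id x).pow 2).const_mul ε).const_add 1) hD using 1
  simp only [id]
  congr 1
  push_cast
  ring

/-- Integrate $(w(p-l))'$ for a weight $w$ comparable to $x^2$. The term $wp'$ controls $wr^2$, and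
$w'(p-l)$ is absorbed because $|p-l|\le4r^2$ far out. Subtracting the limit $l$ is essential: the
bound on $p-l$ is quadratic in $r$. -/
theorem integrableOn_Ioi (h : PolarFlow c K p r e b) :
    IntegrableOn (fun x => x ^ 2 * r x ^ 2) (Set.Ioi 0) := by
  obtain ⟨l, hl, hp⟩ := h.exists_tendsto
  have hc := h.c_pos
  have hr := h.continuous_r
  have hl1 : |l| = 1 :=
    (pow_eq_one_iff_of_nonneg (abs_nonneg l) two_ne_zero).1 (by rw [sq_abs, hl])
  -- $|p-l||p+l|=1-p^2=4r^2$, and $|p+l|\ge1$ as soon as $|p-l|<1$.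
  obtain ⟨X, hX0, hX⟩ : ∃ X, 0 < X ∧ ∀ x, X ≤ x → |p x - l| ≤ 4 * r x ^ 2 := by
    obtain ⟨X, hX⟩ := eventually_atTop.1 (hp.eventually (Metric.ball_mem_nhds l one_pos))
    refine ⟨max X 1, by positivity, fun x hx => ?_⟩
    have h1 := hX x ((le_max_left _ _).trans hx)
    have h1 : |p x - l| < 1 := h1
    have h2 : |p x - l| * |p x + l| = 4 * r x ^ 2 := by
      rw [← abs_mul, show (p x - l) * (p x + l) = -(4 * r x ^ 2) by
        linear_combination h.unit x - hl, abs_neg, abs_of_nonneg (by positivity)]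
    have h3 : 1 ≤ |p x + l| := by
      have h5 : |2 * l| ≤ |p x + l| + |p x - l| := by
        rw [show 2 * l = (p x + l) - (p x - l) by ring]; exact abs_sub _ _
      rw [abs_mul, hl1, abs_two] at h5
      linarith
    nlinarith [abs_nonneg (p x - l)]
  set L := K ^ 2 / (2 * c) with hL
  have hL0 : 0 ≤ L := by positivity
  -- The terms bound, in order, the boundary value at $Y$, the boundary value at $X$ (where $w\le
  -- X^2$ and $|p-l|\le2$), the absorbed error from $w'$, and the perturbation.
  let B : ℝ := 1 + 2 * X ^ 2 + 64 / c * (∫ x, r x ^ 2) + L * ∫ x, x ^ 2 * b x ^ 2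
  have key : IntegrableOn (fun x => x ^ 2 * r x ^ 2) (Set.Ioi X) := by
    refine integrableOn_Ioi_of_intervalIntegral_norm_bounded (l := atTop) (b := fun n : ℝ => n)
      (8 / c * B) X
      (fun n => (Continuous.integrableOn_Icc (by fun_prop)).mono_set Set.Ioc_subset_Icc_self)
      tendsto_id ?_
    filter_upwards [eventually_ge_atTop X] with Z hZ
    have hZ0 : 0 < Z := hX0.trans_le hZ
    -- No rate for $p\to l$ is known, so the integration runs past $Z$ to a point $Y$ where $p-l$ is
    -- small compared with $Z^{-2}$; the weight below is bounded by $Z^2$.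
    obtain ⟨Y, hY, hYZ⟩ : ∃ Y, Z ^ 2 * |p Y - l| ≤ 1 ∧ Z ≤ Y := by
      have h1 : ∀ᶠ y in atTop, |p y - l| < 1 / Z ^ 2 := by
        simpa [Real.dist_eq] using
          hp.eventually (Metric.ball_mem_nhds l (by positivity : 0 < 1 / Z ^ 2))
      obtain ⟨Y, hY, hY'⟩ := (h1.and (eventually_ge_atTop Z)).exists
      refine ⟨Y, ?_, hY'⟩
      rw [lt_div_iff₀ (by positivity)] at hY
      linarith
    -- With this scale $x^2/(1+\varepsilon x^2)$ is at most $Z^2$ everywhere and at least $x^2/2$ on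
    -- $[0,Z]$.
    let ε : ℝ := (Z ^ 2)⁻¹
    have hε : 0 < ε := by positivity
    let w : ℝ → ℝ := fun x => x ^ 2 / (1 + ε * x ^ 2)
    let w' : ℝ → ℝ := fun x => 2 * x / (1 + ε * x ^ 2) ^ 2
    have hD : ∀ x, 1 ≤ 1 + ε * x ^ 2 := fun x => by
      have : 0 ≤ ε * x ^ 2 := by positivity
      linarith
    have hw : ∀ x, HasDerivAt w (w' x) x := weight_hasDerivAt hε
    have hwc : Continuous w := by
      refine Continuous.div (by fun_prop) (by fun_prop) fun x => ?_
      linarith [hD x]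
    have hwc' : Continuous w' := by
      refine Continuous.div (by fun_prop) (by fun_prop) fun x => ?_
      have := hD x
      positivity
    have hw0 : ∀ x, 0 ≤ w x := fun x => by have := hD x; simp only [w]; positivity
    have hwx : ∀ x, w x ≤ x ^ 2 := fun x => div_le_self (sq_nonneg x) (hD x)
    have hwZ : ∀ x, w x ≤ Z ^ 2 := fun x => by
      have := hD x
      simp only [w]
      rw [div_le_iff₀ (by positivity)]
      have h1 : Z ^ 2 * ε = 1 := mul_inv_cancel₀ (by positivity)
      nlinarith [sq_nonneg Z]
    have hwl : ∀ x, 0 ≤ x → x ≤ Z → x ^ 2 / 2 ≤ w x := fun x h0 hx => by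
      have := hD x
      have h1 : ε * x ^ 2 ≤ 1 := by
        simp only [ε]
        rw [inv_mul_le_iff₀ (by positivity), mul_one]
        gcongr
      exact div_le_div_of_nonneg_left (sq_nonneg x) (by positivity) (by linarith)
    have hw'0 : ∀ x, 0 ≤ x → 0 ≤ w' x := fun x hx => by
      have := hD x
      simp only [w']; positivity
    -- After multiplication by $4r^2$ the first term costs $\frac c4wr^2$, half of the $\frac
    -- c2wr^2$ available from $p'$; the second is integrable.
    have hw'w : ∀ x, 0 ≤ x → w' x ≤ c / 16 * w x + 16 / c := fun x hx => by
      have hx1 := hD x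
      have h1 : w' x ≤ 2 * x / (1 + ε * x ^ 2) :=
        div_le_div_of_nonneg_left (by positivity) (by positivity) (by nlinarith)
      have h2 : 2 * x ≤ c / 16 * x ^ 2 + 16 / c := by
        have : c / 16 * x ^ 2 + 16 / c - 2 * x = (c * x - 16) ^ 2 / (16 * c) := by
          field_simp; ring
        have h3 : 0 ≤ (c * x - 16) ^ 2 / (16 * c) := by positivity
        linarith
      calc w' x ≤ 2 * x / (1 + ε * x ^ 2) := h1
        _ ≤ (c / 16 * x ^ 2 + 16 / c) / (1 + ε * x ^ 2) := by gcongr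
        _ = c / 16 * w x + 16 / c / (1 + ε * x ^ 2) := by simp only [w]; ring
        _ ≤ _ := by
          have := div_le_self (by positivity : 0 ≤ 16 / c) hx1
          linarith
    have hpc : Continuous p :=
      continuous_iff_continuousAt.2 fun x => (h.hasDerivAt x).continuousAt
    have hWd : ∀ x, HasDerivAt (fun t => w t * (p t - l))
        (w' x * (p x - l) + w x * (c * r x ^ 2 + e x)) x := fun x =>
      (hw x).mul ((h.hasDerivAt x).sub_const l)
    have hWc : Continuous fun x => w' x * (p x - l) + w x * (c * r x ^ 2 + e x) :=
      (hwc'.mul (hpc.sub continuous_const)).add (hwc.mul h.continuous_deriv)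
    have hXY := hZ.trans hYZ
    have hpt : ∀ x ∈ Set.Icc X Y, c / 4 * (w x * r x ^ 2) ≤
        (w' x * (p x - l) + w x * (c * r x ^ 2 + e x)) + (64 / c * r x ^ 2
          + L * (x ^ 2 * b x ^ 2)) := by
      intro x hx
      have hx0 : 0 ≤ x := hX0.le.trans hx.1
      have h1 : -(w' x * (4 * r x ^ 2)) ≤ w' x * (p x - l) := by
        have := (abs_le.1 (hX x hx.1)).1
        have := mul_le_mul_of_nonneg_left this (hw'0 x hx0)
        linarith
      have h2 := mul_le_mul_of_nonneg_right (hw'w x hx0)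
        (by positivity : (0 : ℝ) ≤ 4 * r x ^ 2)
      have h3 := mul_le_mul_of_nonneg_left (h.le_deriv x) (hw0 x)
      have h4 : w x * (L * b x ^ 2) ≤ x ^ 2 * (L * b x ^ 2) :=
        mul_le_mul_of_nonneg_right (hwx x) (by positivity)
      have h5 : 16 / c * (4 * r x ^ 2) = 64 / c * r x ^ 2 := by ring
      rw [← hL] at h3
      nlinarith
    have hi1 : IntervalIntegrable (fun x => 64 / c * r x ^ 2) volume X Y :=
      (h.integrable_r.const_mul _).intervalIntegrable
    have hi2 : IntervalIntegrable (fun x => L * (x ^ 2 * b x ^ 2)) volume X Y :=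
      (h.integrable_xb.const_mul _).intervalIntegrable
    have hmain := intervalIntegral.integral_mono_on hXY
      (Continuous.intervalIntegrable (by fun_prop) _ _)
      ((hWc.intervalIntegrable X Y).add (hi1.add hi2)) hpt
    rw [intervalIntegral.integral_add (hWc.intervalIntegrable X Y) (hi1.add hi2),
      intervalIntegral.integral_add hi1 hi2,
      intervalIntegral.integral_eq_sub_of_hasDerivAt (fun t _ => hWd t)
        (hWc.intervalIntegrable _ _), intervalIntegral.integral_const_mul,
      intervalIntegral.integral_const_mul, intervalIntegral.integral_const_mul] at hmain
    have hb1 : w Y * (p Y - l) ≤ 1 := by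
      calc w Y * (p Y - l) ≤ w Y * |p Y - l| :=
            mul_le_mul_of_nonneg_left (le_abs_self _) (hw0 Y)
        _ ≤ Z ^ 2 * |p Y - l| := mul_le_mul_of_nonneg_right (hwZ Y) (abs_nonneg _)
        _ ≤ 1 := hY
    have hb2 : -(2 * X ^ 2) ≤ w X * (p X - l) := by
      have h1 : |p X - l| ≤ 2 := by
        linarith [abs_sub (p X) l, hl1, h.abs_le_one X]
      have h2 := (abs_le.1 h1).1
      nlinarith [hw0 X, hwx X]
    have hb3 := mul_le_mul_of_nonneg_left
      (intervalIntegral_le_integral h.integrable_r (fun x => sq_nonneg _) hXY)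
      (by positivity : 0 ≤ 64 / c)
    have hb4 := mul_le_mul_of_nonneg_left
      (intervalIntegral_le_integral h.integrable_xb (fun x => by positivity) hXY) hL0
    have hwr : Continuous fun x => w x * r x ^ 2 := by fun_prop
    have hb5 : ∫ x in X..Z, w x * r x ^ 2 ≤ ∫ x in X..Y, w x * r x ^ 2 :=
      intervalIntegral.integral_mono_interval le_rfl hZ hYZ
        (ae_of_all _ fun x => mul_nonneg (hw0 x) (sq_nonneg _)) (hwr.intervalIntegrable _ _)
    have hb6 : ∫ x in X..Z, x ^ 2 * r x ^ 2 ≤ ∫ x in X..Z, 2 * (w x * r x ^ 2) := by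
      refine intervalIntegral.integral_mono_on hZ
        (Continuous.intervalIntegrable (by fun_prop) _ _)
        ((hwr.intervalIntegrable _ _).const_mul 2) fun x hx => ?_
      have := mul_le_mul_of_nonneg_right (hwl x (hX0.le.trans hx.1) hx.2) (sq_nonneg (r x))
      linarith
    rw [intervalIntegral.integral_const_mul] at hb6
    have hnorm : ∫ x in X..Z, ‖x ^ 2 * r x ^ 2‖ = ∫ x in X..Z, x ^ 2 * r x ^ 2 :=
      intervalIntegral.integral_congr fun x _ => Real.norm_of_nonneg (by positivity)
    rw [hnorm, div_mul_eq_mul_div, le_div_iff₀ hc]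
    simp only [B]
    nlinarith
  have : Set.Ioi (0 : ℝ) ⊆ Set.Icc 0 X ∪ Set.Ioi X := fun x hx => by
    rcases le_or_gt x X with h | h
    · exact Or.inl ⟨le_of_lt hx, h⟩
    · exact Or.inr h
  exact ((Continuous.integrableOn_Icc (by fun_prop)).union key).mono_set this

/-- Reversing both the line and the axis leaves the sign of the derivative unchanged, so the
estimate on the right half-line also serves on the left. -/
theorem reflect (h : PolarFlow c K p r e b) :
    PolarFlow c K (fun x => -p (-x)) (fun x => r (-x)) (fun x => e (-x)) (fun x => b (-x)) where
  c_pos := h.c_pos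
  r_nonneg x := h.r_nonneg _
  hasDerivAt x := by
    convert! ((h.hasDerivAt (-x)).scomp x (hasDerivAt_neg x)).neg using 1
    simp
  unit x := by simpa using h.unit (-x)
  bound x := h.bound _
  continuous_r := h.continuous_r.comp continuous_neg
  continuous_e := h.continuous_e.comp continuous_neg
  integrable_b := h.integrable_b.comp_neg
  integrable_xb := by simpa using h.integrable_xb.comp_neg

theorem integrable_mul_sq (h : PolarFlow c K p r e b) :
    Integrable fun x => x ^ 2 * r x ^ 2 := by
  have h1 := h.integrableOn_Ioi
  have h2 : IntegrableOn (fun x => x ^ 2 * r x ^ 2) (Set.Iic 0) := by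
    have h3 : IntegrableOn (fun x => x ^ 2 * r (-x) ^ 2) (Set.Ici (-0)) := by
      rw [neg_zero, integrableOn_Ici_iff_integrableOn_Ioi]
      exact h.reflect.integrableOn_Ioi
    simpa using h3.comp_neg_Iic
  rw [← integrableOn_univ, ← Set.Iic_union_Ioi (a := (0 : ℝ))]
  exact h2.union h1

end PolarFlow

/-! ### Bounded multipliers on $L^2$ and $H^1$ -/

/-- Continuous bounded functions. -/
def BddCont (a : ℝ → ℂ) : Prop := Continuous a ∧ ∃ M, ∀ x, ‖a x‖ ≤ M

namespace BddCont

variable {a b : ℝ → ℂ}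

theorem const (c : ℂ) : BddCont fun _ => c := ⟨continuous_const, ‖c‖, fun _ => le_rfl⟩

theorem add (ha : BddCont a) (hb : BddCont b) : BddCont fun x => a x + b x := by
  obtain ⟨ha, M, hM⟩ := ha
  obtain ⟨hb, L, hL⟩ := hb
  exact ⟨ha.add hb, M + L, fun x => (norm_add_le _ _).trans (add_le_add (hM x) (hL x))⟩

theorem mul (ha : BddCont a) (hb : BddCont b) : BddCont fun x => a x * b x := by
  obtain ⟨ha, M, hM⟩ := ha
  obtain ⟨hb, L, hL⟩ := hb
  refine ⟨ha.mul hb, M * L, fun x => ?_⟩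
  rw [norm_mul]
  exact mul_le_mul (hM x) (hL x) (norm_nonneg _) ((norm_nonneg _).trans (hM x))

theorem neg (ha : BddCont a) : BddCont fun x => -a x :=
  ⟨ha.1.neg, by simpa using ha.2⟩

theorem sub (ha : BddCont a) (hb : BddCont b) : BddCont fun x => a x - b x := by
  simpa only [sub_eq_add_neg] using ha.add hb.neg

theorem complexConj (ha : BddCont a) : BddCont fun x => conj (a x) :=
  ⟨Complex.continuous_conj.comp ha.1, by simpa using ha.2⟩

theorem inv (ha : Continuous a) {δ : ℝ} (hδ : 0 < δ) (h : ∀ x, δ ≤ ‖a x‖) :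
    BddCont fun x => (a x)⁻¹ := by
  refine ⟨ha.inv₀ fun x hx => ?_, δ⁻¹, fun x => ?_⟩
  · have := h x
    rw [hx, norm_zero] at this
    linarith
  · rw [norm_inv]
    exact inv_anti₀ hδ (h x)

end BddCont

/-- Bounded `C¹` functions with bounded derivative. -/
def BddCont1 (a : ℝ → ℂ) : Prop :=
  BddCont a ∧ ∃ a', (∀ x, HasDerivAt a (a' x) x) ∧ BddCont a'

namespace BddCont1

variable {a b : ℝ → ℂ}

theorem const (c : ℂ) : BddCont1 fun _ => c :=
  ⟨BddCont.const c, _, fun x => hasDerivAt_const x c, BddCont.const 0⟩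

theorem add (ha : BddCont1 a) (hb : BddCont1 b) : BddCont1 fun x => a x + b x := by
  obtain ⟨ha, a', ha', hc⟩ := ha
  obtain ⟨hb, b', hb', hd⟩ := hb
  exact ⟨ha.add hb, _, fun x => (ha' x).add (hb' x), hc.add hd⟩

theorem mul (ha : BddCont1 a) (hb : BddCont1 b) : BddCont1 fun x => a x * b x := by
  obtain ⟨ha, a', ha', hc⟩ := ha
  obtain ⟨hb, b', hb', hd⟩ := hb
  exact ⟨ha.mul hb, _, fun x => (ha' x).mul (hb' x), (hc.mul hb).add (ha.mul hd)⟩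

theorem neg (ha : BddCont1 a) : BddCont1 fun x => -a x := by
  obtain ⟨ha, a', ha', hc⟩ := ha
  exact ⟨ha.neg, _, fun x => (ha' x).neg, hc.neg⟩

theorem sub (ha : BddCont1 a) (hb : BddCont1 b) : BddCont1 fun x => a x - b x := by
  simpa only [sub_eq_add_neg] using ha.add hb.neg

theorem complexConj (ha : BddCont1 a) : BddCont1 fun x => conj (a x) := by
  obtain ⟨ha, a', ha', hc⟩ := ha
  exact ⟨ha.complexConj, _, fun x => (ha' x).star, hc.complexConj⟩

theorem inv (ha : BddCont1 a) {δ : ℝ} (hδ : 0 < δ) (h : ∀ x, δ ≤ ‖a x‖) :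
    BddCont1 fun x => (a x)⁻¹ := by
  obtain ⟨ha, a', ha', hc⟩ := ha
  have hi := BddCont.inv ha.1 hδ h
  have h0 : ∀ x, a x ≠ 0 := fun x hx => by
    have := h x
    rw [hx, norm_zero] at this
    linarith
  refine ⟨hi, fun x => -a' x * ((a x)⁻¹ * (a x)⁻¹), fun x => ?_, hc.neg.mul (hi.mul hi)⟩
  convert! (ha' x).inv (h0 x) using 1
  field_simp

end BddCont1

/-- Absolutely continuous representatives of functions in `H¹(ℝ)`. -/
def MemH1 (F : ℝ → ℂ) : Prop := ∃ g, IsPrimitive F g ∧ MemLp F 2 volume ∧ MemLp g 2 volume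

theorem BddCont.memLp_mul {a f : ℝ → ℂ} (ha : BddCont a) (hf : MemLp f 2 volume) :
    MemLp (fun x => a x * f x) 2 volume := by
  obtain ⟨ha, M, hM⟩ := ha
  refine MemLp.of_le_mul (c := M) hf (ha.aestronglyMeasurable.mul hf.1) (ae_of_all _ fun x => ?_)
  rw [norm_mul]
  exact mul_le_mul_of_nonneg_right (hM x) (norm_nonneg _)

namespace MemH1

variable {a F G : ℝ → ℂ}

theorem add (hF : MemH1 F) (hG : MemH1 G) : MemH1 fun x => F x + G x := by
  obtain ⟨f, h1, h2, h3⟩ := hF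
  obtain ⟨g, k1, k2, k3⟩ := hG
  exact ⟨_, h1.add k1, h2.add k2, h3.add k3⟩

theorem mul (ha : BddCont1 a) (hF : MemH1 F) : MemH1 fun x => a x * F x := by
  obtain ⟨f, h1, h2, h3⟩ := hF
  obtain ⟨ha, a', ha', hc⟩ := ha
  exact ⟨_, h1.mul ha' hc.1, ha.memLp_mul h2, (hc.memLp_mul h2).add (ha.memLp_mul h3)⟩

end MemH1

/-! ### The normalised quadratic quantities of a vector in `ℂ²` -/

/-- The squared Euclidean norm, as a complex number. -/
noncomputable def vecNormSq (v : Fin 2 → ℂ) : ℂ := v 0 * conj (v 0) + v 1 * conj (v 1)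

/-- The normalised product of the components. -/
noncomputable def blochR (v : Fin 2 → ℂ) : ℂ := v 0 * conj (v 1) / vecNormSq v

/-- The normalised difference of the squared moduli of the components. -/
noncomputable def blochP (v : Fin 2 → ℂ) : ℂ :=
  (v 0 * conj (v 0) - v 1 * conj (v 1)) / vecNormSq v

theorem vecNormSq_eq (v : Fin 2 → ℂ) :
    vecNormSq v = ((‖v 0‖ ^ 2 + ‖v 1‖ ^ 2 : ℝ) : ℂ) := by
  simp [vecNormSq, Complex.mul_conj, Complex.normSq_eq_norm_sq]

theorem vecNormSq_ne_zero {v : Fin 2 → ℂ} (hv : v ≠ 0) : vecNormSq v ≠ 0 := by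
  rw [vecNormSq_eq]
  intro h
  have h := Complex.ofReal_eq_zero.1 h
  have h0 : ‖v 0‖ = 0 := by nlinarith [sq_nonneg ‖v 0‖, sq_nonneg ‖v 1‖]
  have h1 : ‖v 1‖ = 0 := by nlinarith [sq_nonneg ‖v 0‖, sq_nonneg ‖v 1‖]
  apply hv
  ext i
  fin_cases i
  · simpa using h0
  · simpa using h1

theorem conj_vecNormSq (v : Fin 2 → ℂ) : conj (vecNormSq v) = vecNormSq v := by
  simp [vecNormSq, mul_comm]

theorem conj_blochP (v : Fin 2 → ℂ) : conj (blochP v) = blochP v := by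
  rw [blochP, map_div₀, conj_vecNormSq]
  simp [mul_comm]

/-- This is the identity $(|f|^2-|g|^2)^2+4|f|^2|g|^2=(|f|^2+|g|^2)^2$: the Bloch vector lies on the
unit sphere. -/
theorem blochP_sq {v : Fin 2 → ℂ} (hv : v ≠ 0) :
    blochP v ^ 2 + 4 * (blochR v * conj (blochR v)) = 1 := by
  have h := vecNormSq_ne_zero hv
  simp only [blochP, blochR, map_div₀, conj_vecNormSq, map_mul, Complex.conj_conj]
  field_simp
  rw [vecNormSq]
  ring

theorem ofReal_re_blochP (v : Fin 2 → ℂ) : (((blochP v).re : ℝ) : ℂ) = blochP v :=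
  Complex.conj_eq_iff_re.1 (conj_blochP v)

theorem blochP_re_sq {v : Fin 2 → ℂ} (hv : v ≠ 0) :
    (blochP v).re ^ 2 + 4 * ‖blochR v‖ ^ 2 = 1 := by
  have h := blochP_sq hv
  rw [← ofReal_re_blochP, Complex.mul_conj, Complex.normSq_eq_norm_sq] at h
  exact_mod_cast h

theorem norm_blochR_le {v : Fin 2 → ℂ} (hv : v ≠ 0) : ‖blochR v‖ ≤ 1 := by
  nlinarith [blochP_re_sq hv, sq_nonneg (blochP v).re, norm_nonneg (blochR v)]

theorem norm_blochP_le {v : Fin 2 → ℂ} (hv : v ≠ 0) : ‖blochP v‖ ≤ 1 := by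
  rw [← ofReal_re_blochP, Complex.norm_real, Real.norm_eq_abs]
  exact abs_le_one_iff_mul_self_le_one.2
    (by nlinarith [blochP_re_sq hv, sq_nonneg ‖blochR v‖])

/-- The denominator of the Darboux transformation after normalisation. -/
noncomputable def darbouxDen (lam : ℂ) (v : Fin 2 → ℂ) : ℂ :=
  (lam * (1 + blochP v) + conj lam * (1 - blochP v)) / 2

/-- As $P$ is real, the denominator is an affine combination of $\lambda$ and $\bar\lambda$, which
have the same real part. This gives the uniform lower bound on its modulus. -/
theorem re_darbouxDen (lam : ℂ) (v : Fin 2 → ℂ) : (darbouxDen lam v).re = lam.re := by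
  rw [darbouxDen, ← ofReal_re_blochP, show (2 : ℂ) = ((2 : ℝ) : ℂ) by simp, Complex.div_ofReal_re]
  simp
  ring

theorem le_norm_darbouxDen (lam : ℂ) (v : Fin 2 → ℂ) : |lam.re| ≤ ‖darbouxDen lam v‖ := by
  rw [← re_darbouxDen lam v]
  exact Complex.abs_re_le_norm _

theorem darbouxDen_ne_zero {lam : ℂ} (hlam : lam.re ≠ 0) (v : Fin 2 → ℂ) :
    darbouxDen lam v ≠ 0 := fun h => hlam (by rw [← re_darbouxDen lam v, h, Complex.zero_re])

theorem mForm_eq {v : Fin 2 → ℂ} (hv : v ≠ 0) (lam : ℂ) :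
    mForm lam v v = vecNormSq v * darbouxDen lam v := by
  have h := vecNormSq_ne_zero hv
  rw [darbouxDen, blochP, mForm]
  field_simp
  rw [vecNormSq]
  ring

theorem mForm_ne_zero {lam : ℂ} (hlam : lam.re ≠ 0) {v : Fin 2 → ℂ} (hv : v ≠ 0) :
    mForm lam v v ≠ 0 := by
  rw [mForm_eq hv]
  exact mul_ne_zero (vecNormSq_ne_zero hv) (darbouxDen_ne_zero hlam v)

theorem darbouxC_eq {lam : ℂ} (hlam : lam.re ≠ 0) {v : Fin 2 → ℂ} (hv : v ≠ 0) :
    darbouxC lam v = (lam + conj lam) * (darbouxDen lam v)⁻¹ - 1 := by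
  have h := vecNormSq_ne_zero hv
  have h2 := darbouxDen_ne_zero hlam v
  -- The denominators for $\lambda$ and $\bar\lambda$ sum to $\lambda+\bar\lambda$, so $C_\lambda$
  -- depends on a single reciprocal.
  have h3 : darbouxDen (conj lam) v = lam + conj lam - darbouxDen lam v := by
    simp only [darbouxDen, Complex.conj_conj]; ring
  rw [darbouxC, mForm_eq hv, mForm_eq hv, h3]
  field_simp

theorem darbouxD_eq {lam : ℂ} (hlam : lam.re ≠ 0) {v : Fin 2 → ℂ} (hv : v ≠ 0) :
    darbouxD lam v = (lam ^ 2 - conj lam ^ 2) * (darbouxDen lam v)⁻¹ * blochR v := by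
  have h := vecNormSq_ne_zero hv
  have h2 := darbouxDen_ne_zero hlam v
  rw [darbouxD, mForm_eq hv, blochR]
  field_simp

/-! ### The evolution of the normalised quantities -/

theorem laxU_mulVec_zero (lam q : ℂ) (v : Fin 2 → ℂ) : (laxU lam q *ᵥ v) 0 =
    (-Complex.I * lam ^ 2 + Complex.I / 4 * (q * conj q)) * v 0 + lam * q * v 1 := by
  simp [laxU, sigmaThree, potentialMatrix, Matrix.mulVec, dotProduct, Fin.sum_univ_two]

theorem laxU_mulVec_one (lam q : ℂ) (v : Fin 2 → ℂ) : (laxU lam q *ᵥ v) 1 =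
    -(-Complex.I * lam ^ 2 + Complex.I / 4 * (q * conj q)) * v 1 - lam * conj q * v 0 := by
  simp [laxU, sigmaThree, potentialMatrix, Matrix.mulVec, dotProduct, Fin.sum_univ_two]
  ring

/-- The logarithmic derivative of the squared norm of a solution. -/
noncomputable def normRate (lam q P R : ℂ) : ℂ :=
  (-Complex.I * lam ^ 2 + Complex.I * conj lam ^ 2) * P
    + (lam - conj lam) * (q * conj R - conj q * R)

/-- The derivative of `blochP` along a solution. -/
noncomputable def rateP (lam q P R : ℂ) : ℂ :=
  (-Complex.I * lam ^ 2 + Complex.I * conj lam ^ 2)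
    + (lam + conj lam) * (q * conj R + conj q * R) - P * normRate lam q P R

/-- The coefficient of `blochR` in its derivative along a solution. -/
noncomputable def rateA (lam q P R : ℂ) : ℂ :=
  (-Complex.I * lam ^ 2 - Complex.I * conj lam ^ 2 + Complex.I / 2 * (q * conj q))
    - normRate lam q P R

/-- The coefficient of `q` in the derivative of `blochR` along a solution. -/
noncomputable def rateB (lam P : ℂ) : ℂ := (lam * (1 - P) - conj lam * (1 + P)) / 2

theorem HasDerivAt.complexConj {f : ℝ → ℂ} {f' : ℂ} {x : ℝ} (h : HasDerivAt f f' x) :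
    HasDerivAt (fun t => conj (f t)) (conj f') x := h.star

section Evolution

variable {lam q : ℂ} {Φ : ℝ → Fin 2 → ℂ} {x : ℝ}

theorem hasDerivAt_vecNormSq (h : HasDerivAt Φ (laxU lam q *ᵥ Φ x) x) (h0 : Φ x ≠ 0) :
    HasDerivAt (fun t => vecNormSq (Φ t))
      (vecNormSq (Φ x) * normRate lam q (blochP (Φ x)) (blochR (Φ x))) x := by
  have hN := vecNormSq_ne_zero h0
  have d0 := hasDerivAt_pi.1 h 0
  have d1 := hasDerivAt_pi.1 h 1
  convert! (d0.mul d0.complexConj).add (d1.mul d1.complexConj) using 1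
  rw [laxU_mulVec_zero, laxU_mulVec_one, normRate, blochP, blochR]
  simp only [map_div₀, conj_vecNormSq, map_mul, map_add, map_sub, map_neg, map_pow,
    Complex.conj_conj, Complex.conj_I, map_ofNat]
  field_simp
  ring

theorem hasDerivAt_blochP (h : HasDerivAt Φ (laxU lam q *ᵥ Φ x) x) (h0 : Φ x ≠ 0) :
    HasDerivAt (fun t => blochP (Φ t)) (rateP lam q (blochP (Φ x)) (blochR (Φ x))) x := by
  have hN := vecNormSq_ne_zero h0
  have d0 := hasDerivAt_pi.1 h 0
  have d1 := hasDerivAt_pi.1 h 1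
  convert! ((d0.mul d0.complexConj).sub (d1.mul d1.complexConj)).div
    (hasDerivAt_vecNormSq h h0) hN using 1
  rw [laxU_mulVec_zero, laxU_mulVec_one, rateP]
  -- The logarithmic derivative of the norm enters both sides linearly, so its value is irrelevant
  -- to the identity.
  generalize normRate lam q (blochP (Φ x)) (blochR (Φ x)) = k
  rw [blochP, blochR]
  simp only [map_div₀, conj_vecNormSq, map_mul, map_add, map_sub, map_neg, map_pow,
    Complex.conj_conj, Complex.conj_I, map_ofNat, Pi.sub_apply, Pi.mul_apply]
  field_simp
  rw [vecNormSq]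
  ring

theorem hasDerivAt_blochR (h : HasDerivAt Φ (laxU lam q *ᵥ Φ x) x) (h0 : Φ x ≠ 0) :
    HasDerivAt (fun t => blochR (Φ t))
      (rateA lam q (blochP (Φ x)) (blochR (Φ x)) * blochR (Φ x) + rateB lam (blochP (Φ x)) * q)
      x := by
  have hN := vecNormSq_ne_zero h0
  have d0 := hasDerivAt_pi.1 h 0
  have d1 := hasDerivAt_pi.1 h 1
  convert! (d0.mul d1.complexConj).div (hasDerivAt_vecNormSq h h0) hN using 1
  rw [laxU_mulVec_zero, laxU_mulVec_one, rateA, rateB]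
  generalize normRate lam q (blochP (Φ x)) (blochR (Φ x)) = k
  rw [blochP, blochR]
  simp only [map_div₀, map_mul, map_add, map_sub, map_neg, map_pow,
    Complex.conj_conj, Complex.conj_I, map_ofNat, Pi.mul_apply]
  field_simp
  rw [vecNormSq]
  ring

end Evolution

/-! ### Boundedness and sign structure of the rates -/

section Rates

variable {lam : ℂ} {q P R : ℝ → ℂ}

theorem BddCont.normRate (lam : ℂ) (hq : BddCont q) (hP : BddCont P) (hR : BddCont R) :
    BddCont fun x => normRate lam (q x) (P x) (R x) :=
  ((const _).mul hP).add ((const _).mul ((hq.mul hR.complexConj).sub (hq.complexConj.mul hR)))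

theorem BddCont.rateP (lam : ℂ) (hq : BddCont q) (hP : BddCont P) (hR : BddCont R) :
    BddCont fun x => rateP lam (q x) (P x) (R x) :=
  ((const _).add ((const _).mul ((hq.mul hR.complexConj).add (hq.complexConj.mul hR)))).sub
    (hP.mul (hq.normRate lam hP hR))

theorem BddCont.rateA (lam : ℂ) (hq : BddCont q) (hP : BddCont P) (hR : BddCont R) :
    BddCont fun x => rateA lam (q x) (P x) (R x) :=
  ((const _).add ((const _).mul (hq.mul hq.complexConj))).sub (hq.normRate lam hP hR)

theorem BddCont.rateB (lam : ℂ) (hP : BddCont P) : BddCont fun x => rateB lam (P x) := by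
  simp only [_root_.rateB, div_eq_mul_inv]
  exact (((const _).mul ((const _).sub hP)).sub ((const _).mul ((const _).add hP))).mul (const _)

theorem BddCont1.normRate (lam : ℂ) (hq : BddCont1 q) (hP : BddCont1 P) (hR : BddCont1 R) :
    BddCont1 fun x => normRate lam (q x) (P x) (R x) :=
  ((const _).mul hP).add ((const _).mul ((hq.mul hR.complexConj).sub (hq.complexConj.mul hR)))

theorem BddCont1.rateP (lam : ℂ) (hq : BddCont1 q) (hP : BddCont1 P) (hR : BddCont1 R) :
    BddCont1 fun x => rateP lam (q x) (P x) (R x) :=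
  ((const _).add ((const _).mul ((hq.mul hR.complexConj).add (hq.complexConj.mul hR)))).sub
    (hP.mul (hq.normRate lam hP hR))

theorem BddCont1.rateA (lam : ℂ) (hq : BddCont1 q) (hP : BddCont1 P) (hR : BddCont1 R) :
    BddCont1 fun x => rateA lam (q x) (P x) (R x) :=
  ((const _).add ((const _).mul (hq.mul hq.complexConj))).sub (hq.normRate lam hP hR)

theorem BddCont1.rateB (lam : ℂ) (hP : BddCont1 P) : BddCont1 fun x => rateB lam (P x) := by
  simp only [_root_.rateB, div_eq_mul_inv]
  exact (((const _).mul ((const _).sub hP)).sub ((const _).mul ((const _).add hP))).mul (const _)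

end Rates

/-- $\operatorname{Im}\lambda^2=2\operatorname{Re}\lambda\operatorname{Im}\lambda$. -/
theorem ne_zero_re_of_im_sq_pos {lam : ℂ} (h : 0 < (lam ^ 2).im) : lam.re ≠ 0 := by
  intro h0
  rw [sq, Complex.mul_im, h0] at h
  simp at h

theorem neg_I_mul_sq_add (lam : ℂ) :
    -Complex.I * lam ^ 2 + Complex.I * conj lam ^ 2 = ((2 * (lam ^ 2).im : ℝ) : ℂ) := by
  rw [← map_pow]
  have := Complex.sub_conj (lam ^ 2)
  push_cast at this ⊢
  linear_combination (-Complex.I) * this + (-2 * ((lam ^ 2).im : ℂ)) * Complex.I_sq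

theorem norm_mul_conj_add_le (q R : ℂ) : ‖q * conj R + conj q * R‖ ≤ 2 * (‖q‖ * ‖R‖) := by
  refine (norm_add_le _ _).trans (le_of_eq ?_)
  simp only [norm_mul, RCLike.norm_conj]; ring

theorem norm_mul_conj_sub_le (q R : ℂ) : ‖q * conj R - conj q * R‖ ≤ 2 * (‖q‖ * ‖R‖) := by
  refine (norm_sub_le _ _).trans (le_of_eq ?_)
  simp only [norm_mul, RCLike.norm_conj]; ring

/-- The part of the derivative of `blochP` which is due to the potential. -/
noncomputable def rateE (lam q P R : ℂ) : ℂ :=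
  (lam + conj lam) * (q * conj R + conj q * R) - P * ((lam - conj lam) * (q * conj R - conj q * R))

theorem norm_rateE_le {lam q P R : ℂ} (hP : ‖P‖ ≤ 1) :
    ‖rateE lam q P R‖ ≤ 8 * ‖lam‖ * (‖q‖ * ‖R‖) := by
  have h1 : ‖lam + conj lam‖ ≤ 2 * ‖lam‖ := by
    refine (norm_add_le _ _).trans (le_of_eq ?_)
    rw [RCLike.norm_conj]; ring
  have h2 : ‖lam - conj lam‖ ≤ 2 * ‖lam‖ := by
    refine (norm_sub_le _ _).trans (le_of_eq ?_)
    rw [RCLike.norm_conj]; ring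
  have h3 := mul_le_mul h1 (norm_mul_conj_add_le q R) (norm_nonneg _) (by positivity)
  have h4 := mul_le_mul hP (mul_le_mul h2 (norm_mul_conj_sub_le q R) (norm_nonneg _)
    (by positivity)) (by positivity) zero_le_one
  calc _ ≤ _ := norm_sub_le _ _
    _ ≤ 2 * ‖lam‖ * (2 * (‖q‖ * ‖R‖)) + 1 * (2 * ‖lam‖ * (2 * (‖q‖ * ‖R‖))) := by
      rw [norm_mul, norm_mul, norm_mul (lam - conj lam)]
      exact add_le_add h3 h4
    _ = _ := by ring

/-- The part of the rate free of $q$ is $2\operatorname{Im}(\lambda^2)(1-P^2)$, and $1-P^2=4|R|^2$.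
This exhibits the term of fixed sign that drives the decay of $R$. -/
theorem rateP_eq {lam q : ℂ} {v : Fin 2 → ℂ} (hv : v ≠ 0) :
    rateP lam q (blochP v) (blochR v) =
      ((8 * (lam ^ 2).im * ‖blochR v‖ ^ 2 : ℝ) : ℂ) + rateE lam q (blochP v) (blochR v) := by
  have h1 := blochP_sq hv
  have h2 := neg_I_mul_sq_add lam
  have h3 : blochR v * conj (blochR v) = ((‖blochR v‖ ^ 2 : ℝ) : ℂ) := by
    rw [Complex.mul_conj, Complex.normSq_eq_norm_sq]
  rw [h3] at h1
  rw [rateP, normRate, rateE, h2]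
  push_cast at h1 ⊢
  linear_combination (2 * ((lam ^ 2).im : ℂ)) * (-h1)

/-! ### Decay of the seed direction and regularity of the transform -/

section Transform

variable {lam : ℂ} {q q₁ q₂ : ℝ → ℂ} {Φ : ℝ → Fin 2 → ℂ}

theorem bddCont_blochP (hΦ : ∀ x, HasDerivAt Φ (laxU lam (q x) *ᵥ Φ x) x) (h0 : ∀ x, Φ x ≠ 0) :
    BddCont fun x => blochP (Φ x) :=
  ⟨continuous_iff_continuousAt.2 fun x => (hasDerivAt_blochP (hΦ x) (h0 x)).continuousAt,
    1, fun x => norm_blochP_le (h0 x)⟩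

theorem bddCont_blochR (hΦ : ∀ x, HasDerivAt Φ (laxU lam (q x) *ᵥ Φ x) x) (h0 : ∀ x, Φ x ≠ 0) :
    BddCont fun x => blochR (Φ x) :=
  ⟨continuous_iff_continuousAt.2 fun x => (hasDerivAt_blochR (hΦ x) (h0 x)).continuousAt,
    1, fun x => norm_blochR_le (h0 x)⟩

theorem SobolevRep.bddCont (hq : SobolevRep q q₁ q₂) : BddCont q :=
  ⟨hq.isPrimitive.continuous, hq.bounded⟩

theorem SobolevRep.bddCont1 (hq : SobolevRep q q₁ q₂) : BddCont1 q :=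
  ⟨hq.bddCont, q₁, hq.hasDerivAt, hq.prim.continuous, hq.bounded_deriv⟩

theorem polarFlow_bloch (hlam : 0 < (lam ^ 2).im) (hq : SobolevRep q q₁ q₂)
    (hΦ : ∀ x, HasDerivAt Φ (laxU lam (q x) *ᵥ Φ x) x) (h0 : ∀ x, Φ x ≠ 0) :
    PolarFlow (8 * (lam ^ 2).im) (8 * ‖lam‖) (fun x => (blochP (Φ x)).re)
      (fun x => ‖blochR (Φ x)‖) (fun x => (rateE lam (q x) (blochP (Φ x)) (blochR (Φ x))).re)
      (fun x => ‖q x‖) where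
  c_pos := by positivity
  r_nonneg x := norm_nonneg _
  hasDerivAt x := by
    have h := hasDerivAt_blochP (hΦ x) (h0 x)
    rw [rateP_eq (h0 x)] at h
    convert! Complex.reCLM.hasFDerivAt.comp_hasDerivAt x h using 1
  unit x := blochP_re_sq (h0 x)
  bound x := (Complex.abs_re_le_norm _).trans (norm_rateE_le (norm_blochP_le (h0 x)))
  continuous_r := (bddCont_blochR hΦ h0).1.norm
  continuous_e := by
    have h1 := hq.bddCont.1
    have h2 := (bddCont_blochP hΦ h0).1
    have h3 := (bddCont_blochR hΦ h0).1
    unfold rateE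
    fun_prop
  integrable_b := hq.weighted.integrable_sq
  integrable_xb := hq.weighted.integrable_mul_sq

theorem memL2Weighted_blochR (hlam : 0 < (lam ^ 2).im) (hq : SobolevRep q q₁ q₂)
    (hΦ : ∀ x, HasDerivAt Φ (laxU lam (q x) *ᵥ Φ x) x) (h0 : ∀ x, Φ x ≠ 0) :
    MemL2Weighted 1 fun x => blochR (Φ x) := by
  have h := polarFlow_bloch hlam hq hΦ h0
  refine memL2Weighted_one_iff.2 ⟨(bddCont_blochR hΦ h0).1.aestronglyMeasurable, ?_⟩
  refine (h.integrable_r.add h.integrable_mul_sq).congr (ae_of_all _ fun x => ?_)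
  simp only [Pi.add_apply]; ring

/-- The Darboux transformation with a nowhere vanishing seed preserves `H²(ℝ) ∩ H^{1,1}(ℝ)`. -/
theorem SobolevRep.darbouxB (hlam : 0 < (lam ^ 2).im) (hq : SobolevRep q q₁ q₂)
    (hΦ : ∀ x, HasDerivAt Φ (laxU lam (q x) *ᵥ Φ x) x) (h0 : ∀ x, Φ x ≠ 0) :
    ∃ v₁ v₂, SobolevRep (darbouxB lam Φ q) v₁ v₂ := by
  have hre := ne_zero_re_of_im_sq_pos hlam
  have hP0 := bddCont_blochP hΦ h0
  have hR0 := bddCont_blochR hΦ h0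
  have hq0 := hq.bddCont
  have hq1 := hq.bddCont1
  have dP := fun x => hasDerivAt_blochP (hΦ x) (h0 x)
  have dR := fun x => hasDerivAt_blochR (hΦ x) (h0 x)
  have hP1 : BddCont1 fun x => blochP (Φ x) := ⟨hP0, _, dP, hq0.rateP lam hP0 hR0⟩
  have hR1 : BddCont1 fun x => blochR (Φ x) :=
    ⟨hR0, _, dR, ((hq0.rateA lam hP0 hR0).mul hR0).add ((BddCont.rateB lam hP0).mul hq0)⟩
  set P' : ℝ → ℂ := fun x => rateP lam (q x) (blochP (Φ x)) (blochR (Φ x)) with hP'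
  have hP'1 : BddCont1 P' := hq1.rateP lam hP1 hR1
  set R' : ℝ → ℂ := fun x => rateA lam (q x) (blochP (Φ x)) (blochR (Φ x)) * blochR (Φ x) +
    rateB lam (blochP (Φ x)) * q x with hR'
  -- the reciprocal of the denominator and its derivative
  set ν : ℝ → ℂ := fun x => (darbouxDen lam (Φ x))⁻¹ with hν
  have hden : BddCont1 fun x => darbouxDen lam (Φ x) := by
    simp only [darbouxDen, div_eq_mul_inv]
    exact (((BddCont1.const _).mul ((BddCont1.const _).add hP1)).add
      ((BddCont1.const _).mul ((BddCont1.const _).sub hP1))).mul (BddCont1.const _)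
  have hν1 : BddCont1 ν := hden.inv (abs_pos.2 hre) fun x => le_norm_darbouxDen _ _
  set ν' : ℝ → ℂ := fun x => -((lam - conj lam) / 2 * P' x) * (ν x * ν x) with hν'
  have hν'1 : BddCont1 ν' := ((BddCont1.const _).mul hP'1).neg.mul (hν1.mul hν1)
  have dν : ∀ x, HasDerivAt ν (ν' x) x := fun x => by
    have h1 := ((((dP x).const_add 1).const_mul lam).add
      (((dP x).const_sub 1).const_mul (conj lam))).div_const 2
    have h2 := h1.inv (darbouxDen_ne_zero hre (Φ x))
    convert! h2 using 1
    have h3 := darbouxDen_ne_zero hre (Φ x)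
    simp only [ν', ν, P']
    change _ = _ / (darbouxDen lam (Φ x)) ^ 2
    field_simp
    ring
  -- the transformed potential
  set s : ℂ := lam + conj lam
  set k : ℂ := -(2 * Complex.I * (lam ^ 2 - conj lam ^ 2)) with hk
  -- The transform is a combination of $q$ and $R$ whose coefficients involve the seed only through
  -- $1/d$; these coefficients and their derivatives are bounded $C^1$ multipliers with bounded
  -- derivatives.
  have hB : ∀ x, _root_.darbouxB lam Φ q x =
      (s * ν x - 1) * q x + (k * ν x) * blochR (Φ x) := fun x => by
    rw [_root_.darbouxB, darbouxC_eq hre (h0 x), darbouxD_eq hre (h0 x)]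
    simp only [ν, k, s]; ring
  have hC : BddCont1 fun x => s * ν x - 1 :=
    ((BddCont1.const _).mul hν1).sub (BddCont1.const _)
  have hD : BddCont1 fun x => k * ν x := (BddCont1.const _).mul hν1
  have hC' : BddCont1 fun x => s * ν' x := (BddCont1.const _).mul hν'1
  have hD' : BddCont1 fun x => k * ν' x := (BddCont1.const _).mul hν'1
  have dB : ∀ x, HasDerivAt (_root_.darbouxB lam Φ q)
      ((s * ν' x * q x + (s * ν x - 1) * q₁ x) +
        (k * ν' x * blochR (Φ x) + k * ν x * R' x)) x := fun x => by
    rw [funext hB]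
    exact ((((dν x).const_mul s).sub_const 1).mul (hq.hasDerivAt x)).add
      (((dν x).const_mul k).mul (dR x))
  have wR := memL2Weighted_blochR hlam hq hΦ h0
  have wR' : MemL2Weighted 1 R' :=
    (wR.bounded_mul (hq0.rateA lam hP0 hR0).1 (hq0.rateA lam hP0 hR0).2).add
      (hq.weighted.bounded_mul (BddCont.rateB lam hP0).1 (BddCont.rateB lam hP0).2)
  have sq0 : MemH1 q := ⟨q₁, hq.isPrimitive, hq.weighted.1, hq.weighted_deriv.1⟩
  have sq1 : MemH1 q₁ := ⟨q₂, hq.prim, hq.weighted_deriv.1, hq.memLp⟩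
  have cR' : Continuous R' :=
    (((hq0.rateA lam hP0 hR0).mul hR0).add ((BddCont.rateB lam hP0).mul hq0)).1
  have sR : MemH1 fun x => blochR (Φ x) :=
    ⟨R', IsPrimitive.of_hasDerivAt dR cR', wR.1, wR'.1⟩
  -- Bootstrap: $R'=AR+Bq$ with $R,q\in H^1$, so $R$ gains one more derivative.
  have sR' : MemH1 R' := (sR.mul (hq1.rateA lam hP1 hR1)).add (sq0.mul (BddCont1.rateB lam hP1))
  obtain ⟨v₂, hv, -, hv2⟩ :=
    ((sq0.mul hC').add (sq1.mul hC)).add ((sR.mul hD').add (sR'.mul hD))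
  refine ⟨_, v₂, dB, hv, ?_, ?_, hv2⟩
  · rw [funext hB]
    exact (hq.weighted.bounded_mul hC.1.1 hC.1.2).add (wR.bounded_mul hD.1.1 hD.1.2)
  · exact ((hq.weighted.bounded_mul hC'.1.1 hC'.1.2).add
      (hq.weighted_deriv.bounded_mul hC.1.1 hC.1.2)).add
      ((wR.bounded_mul hD'.1.1 hD'.1.2).add (wR'.bounded_mul hD.1.1 hD.1.2))

end Transform

/-! ### Solutions of the spectral problem: uniqueness and the Wronskian -/

section Solutions

variable {lam : ℂ} {q u : ℝ → ℂ} {Φ Ψ : ℝ → Fin 2 → ℂ}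

theorem continuous_laxU_mulVec (hu : Continuous u) (hΦ : Continuous Φ) :
    Continuous fun x => laxU lam (u x) *ᵥ Φ x := by
  have h0 : Continuous fun x => Φ x 0 := (continuous_apply 0).comp hΦ
  have h1 : Continuous fun x => Φ x 1 := (continuous_apply 1).comp hΦ
  refine continuous_pi fun i => ?_
  fin_cases i
  · simp only [Fin.zero_eta, laxU_mulVec_zero]; fun_prop
  · simp only [Fin.mk_one, laxU_mulVec_one]; fun_prop

theorem laxU_integral_congr (hqu : q =ᵐ[volume] u) (x y : ℝ) :
    ∫ z in x..y, laxU lam (q z) *ᵥ Φ z = ∫ z in x..y, laxU lam (u z) *ᵥ Φ z :=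
  intervalIntegral.integral_congr_ae (hqu.mono fun z hz _ => by rw [hz])

theorem SolvesSpectralProblem.hasDerivAt (h : SolvesSpectralProblem q lam Φ)
    (hqu : q =ᵐ[volume] u) (hu : Continuous u) (x : ℝ) :
    HasDerivAt Φ (laxU lam (u x) *ᵥ Φ x) x := by
  have h1 : Φ = fun y => Φ 0 + ∫ z in (0 : ℝ)..y, laxU lam (u z) *ᵥ Φ z := funext fun y => by
    rw [← laxU_integral_congr hqu, ← h.2]; abel
  have hc := continuous_laxU_mulVec (lam := lam) hu h.1
  have := (intervalIntegral.integral_hasDerivAt_right (hc.intervalIntegrable 0 x)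
      (hc.stronglyMeasurableAtFilter _ _) hc.continuousAt).const_add (Φ 0)
  rwa [← h1] at this

theorem solvesSpectralProblem_of_hasDerivAt (hqu : q =ᵐ[volume] u) (hu : Continuous u)
    (h : ∀ x, HasDerivAt Φ (laxU lam (u x) *ᵥ Φ x) x) : SolvesSpectralProblem q lam Φ := by
  have hΦ : Continuous Φ := continuous_iff_continuousAt.2 fun x => (h x).continuousAt
  refine ⟨hΦ, fun x y => ?_⟩
  rw [laxU_integral_congr hqu, intervalIntegral.integral_eq_sub_of_hasDerivAt (fun t _ => h t)
    ((continuous_laxU_mulVec hu hΦ).intervalIntegrable _ _)]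

theorem norm_laxU_mulVec_le (lam q : ℂ) (v : Fin 2 → ℂ) :
    ‖laxU lam q *ᵥ v‖ ≤ (‖lam‖ ^ 2 + ‖q‖ ^ 2 / 4 + ‖lam‖ * ‖q‖) * ‖v‖ := by
  have hμ : ‖-Complex.I * lam ^ 2 + Complex.I / 4 * (q * conj q)‖ ≤ ‖lam‖ ^ 2 + ‖q‖ ^ 2 / 4 := by
    refine (norm_add_le _ _).trans (le_of_eq ?_)
    simp only [norm_mul, norm_neg, norm_div, Complex.norm_I, norm_pow, RCLike.norm_conj,
      Complex.norm_ofNat]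
    ring
  have h0 := norm_le_pi_norm v 0
  have h1 := norm_le_pi_norm v 1
  refine (pi_norm_le_iff_of_nonneg (by positivity)).2 fun i => ?_
  fin_cases i
  · simp only [Fin.zero_eta, laxU_mulVec_zero]
    refine (norm_add_le _ _).trans ?_
    rw [norm_mul, norm_mul, norm_mul, add_mul]
    gcongr
  · simp only [Fin.mk_one, laxU_mulVec_one]
    refine (norm_sub_le _ _).trans ?_
    rw [norm_mul, norm_mul, norm_mul, norm_neg, RCLike.norm_conj, add_mul]
    gcongr

/-- Boundedness of $u$ makes the linear vector field Lipschitz with a constant independent of $x$.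
-/
theorem laxU_solution_unique (hb : ∃ M, ∀ x, ‖u x‖ ≤ M)
    (hΦ : ∀ x, HasDerivAt Φ (laxU lam (u x) *ᵥ Φ x) x)
    (hΨ : ∀ x, HasDerivAt Ψ (laxU lam (u x) *ᵥ Ψ x) x) {x₀ : ℝ} (h : Φ x₀ = Ψ x₀) : Φ = Ψ := by
  obtain ⟨M, hM⟩ := hb
  have hM0 : 0 ≤ M := (norm_nonneg _).trans (hM 0)
  refine ODE_solution_unique_univ (v := fun t y => laxU lam (u t) *ᵥ y) (s := fun _ => Set.univ)
    (K := (‖lam‖ ^ 2 + M ^ 2 / 4 + ‖lam‖ * M).toNNReal) (t₀ := x₀) (fun t => ?_)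
    (fun t => ⟨hΦ t, trivial⟩) (fun t => ⟨hΨ t, trivial⟩) h
  refine LipschitzOnWith.of_dist_le_mul fun y _ z _ => ?_
  rw [dist_eq_norm, dist_eq_norm, ← Matrix.mulVec_sub, Real.coe_toNNReal _ (by positivity)]
  refine (norm_laxU_mulVec_le _ _ _).trans ?_
  have := hM t
  gcongr

theorem laxU_solution_ne_zero (hb : ∃ M, ∀ x, ‖u x‖ ≤ M)
    (hΦ : ∀ x, HasDerivAt Φ (laxU lam (u x) *ᵥ Φ x) x) (hne : Φ ≠ 0) (x : ℝ) : Φ x ≠ 0 := by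
  intro h0
  refine hne (laxU_solution_unique hb hΦ (Ψ := 0) (fun t => ?_) (x₀ := x) h0)
  simp

/-- The coefficient matrix has trace zero. -/
theorem laxU_wronskian_const (hΦ : ∀ x, HasDerivAt Φ (laxU lam (u x) *ᵥ Φ x) x)
    (hΨ : ∀ x, HasDerivAt Ψ (laxU lam (u x) *ᵥ Ψ x) x) (x y : ℝ) :
    Φ x 0 * Ψ x 1 - Φ x 1 * Ψ x 0 = Φ y 0 * Ψ y 1 - Φ y 1 * Ψ y 0 := by
  have hd : ∀ x, HasDerivAt (fun x => Φ x 0 * Ψ x 1 - Φ x 1 * Ψ x 0) 0 x := fun x => by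
    have a0 := hasDerivAt_pi.1 (hΦ x) 0
    have a1 := hasDerivAt_pi.1 (hΦ x) 1
    have b0 := hasDerivAt_pi.1 (hΨ x) 0
    have b1 := hasDerivAt_pi.1 (hΨ x) 1
    convert! (a0.mul b1).sub (a1.mul b0) using 1
    simp only [laxU_mulVec_zero, laxU_mulVec_one]
    ring
  exact is_const_of_deriv_eq_zero (fun x => (hd x).differentiableAt) (fun x => (hd x).deriv) x y

end Solutions

/-! ### Uniqueness of the Jost function -/

theorem norm_exp_neg_I_mul (lam : ℂ) (x : ℝ) :
    ‖Complex.exp (-Complex.I * lam ^ 2 * x)‖ = Real.exp ((lam ^ 2).im * x) := by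
  rw [Complex.norm_exp]
  congr 1
  rw [Complex.re_mul_ofReal]
  simp

theorem seedSolution_injective (lam : ℂ) : Function.Injective (seedSolution lam) := by
  intro φ ψ h
  funext x
  exact smul_right_injective _ (Complex.exp_ne_zero _) (congrFun h x)

namespace IsJostMinus

variable {lam : ℂ} {q u : ℝ → ℂ} {φ ψ : ℝ → Fin 2 → ℂ}

theorem hasDerivAt (h : IsJostMinus q lam φ) (hqu : q =ᵐ[volume] u) (hu : Continuous u) (x : ℝ) :
    HasDerivAt (seedSolution lam φ) (laxU lam (u x) *ᵥ seedSolution lam φ x) x :=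
  h.solves.hasDerivAt hqu hu x

theorem ne_zero (h : IsJostMinus q lam φ) (hqu : q =ᵐ[volume] u) (hu : Continuous u)
    (hb : ∃ M, ∀ x, ‖u x‖ ≤ M) (x : ℝ) : seedSolution lam φ x ≠ 0 := by
  refine laxU_solution_ne_zero hb (h.hasDerivAt hqu hu) (fun h0 => ?_) x
  have : φ = 0 := seedSolution_injective lam (by rw [h0]; funext x; simp [seedSolution])
  have h1 := h.tendsto_atBot
  rw [this] at h1
  have h2 := congrFun (tendsto_nhds_unique h1 tendsto_const_nhds) 0
  simp at h2

/-- The Wronskian vanishes, so the two solutions are proportional at $0$ and hence everywhere; the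
common limit at $-\infty$ forces the factor to be $1$. -/
theorem unique (hlam : 0 < (lam ^ 2).im) (h : IsJostMinus q lam φ) (h' : IsJostMinus q lam ψ)
    (hqu : q =ᵐ[volume] u) (hu : Continuous u) (hb : ∃ M, ∀ x, ‖u x‖ ≤ M) : φ = ψ := by
  set Φ := seedSolution lam φ with hΦ
  set Ψ := seedSolution lam ψ with hΨ
  have dΦ := h.hasDerivAt hqu hu
  have dΨ := h'.hasDerivAt hqu hu
  have c0 := tendsto_pi_nhds.1 h.tendsto_atBot 0
  have c1 := tendsto_pi_nhds.1 h.tendsto_atBot 1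
  have e0 := tendsto_pi_nhds.1 h'.tendsto_atBot 0
  have e1 := tendsto_pi_nhds.1 h'.tendsto_atBot 1
  have hexp : Tendsto (fun x : ℝ => Complex.exp (-Complex.I * lam ^ 2 * x)) atBot (𝓝 0) := by
    rw [tendsto_zero_iff_norm_tendsto_zero]
    simp only [norm_exp_neg_I_mul]
    exact Real.tendsto_exp_atBot.comp (tendsto_id.const_mul_atBot hlam)
  have hW : Tendsto (fun x => Φ x 0 * Ψ x 1 - Φ x 1 * Ψ x 0) atBot (𝓝 0) := by
    -- The Wronskian is $e^{-2i\lambda^2x}$, which decays at $-\infty$, times an expression in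
    -- $\varphi,\psi$ that converges.
    have := (hexp.mul hexp).mul ((c0.mul e1).sub (c1.mul e0))
    simp only [zero_mul] at this
    refine this.congr fun x => ?_
    simp only [hΦ, hΨ, seedSolution, Pi.smul_apply, smul_eq_mul]
    ring
  have hW0 : Φ 0 0 * Ψ 0 1 - Φ 0 1 * Ψ 0 0 = 0 := by
    refine tendsto_nhds_unique ?_ hW
    exact tendsto_const_nhds.congr fun x => laxU_wronskian_const dΦ dΨ 0 x
  obtain ⟨c, hc⟩ : ∃ c : ℂ, Ψ 0 = c • Φ 0 := by
    have hne := h.ne_zero hqu hu hb 0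
    by_cases h00 : Φ 0 0 = 0
    · have h01 : Φ 0 1 ≠ 0 := fun h01 => hne (by
        ext i
        fin_cases i
        · exact h00
        · exact h01)
      refine ⟨Ψ 0 1 / Φ 0 1, ?_⟩
      ext i
      fin_cases i
      · simp only [Fin.zero_eta, Pi.smul_apply, smul_eq_mul, h00, mul_zero]
        rw [h00, zero_mul, zero_sub, neg_eq_zero] at hW0
        exact (mul_eq_zero.1 hW0).resolve_left h01
      · simp only [Fin.mk_one, Pi.smul_apply, smul_eq_mul]
        field_simp
    · refine ⟨Ψ 0 0 / Φ 0 0, ?_⟩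
      ext i
      fin_cases i
      · simp only [Fin.zero_eta, Pi.smul_apply, smul_eq_mul]
        field_simp
      · simp only [Fin.mk_one, Pi.smul_apply, smul_eq_mul]
        field_simp
        linear_combination hW0
  have hΨc : Ψ = fun x => c • Φ x :=
    laxU_solution_unique hb dΨ (fun x => by
      simpa only [Matrix.mulVec_smul] using! (dΦ x).const_smul c) hc
  have hψc : ψ = fun x => c • φ x := seedSolution_injective lam (by
    rw [← hΨ, hΨc]
    funext x
    simp only [hΦ, seedSolution]
    rw [smul_comm])
  have hc1 : c = 1 := by
    have h1 : Tendsto ψ atBot (𝓝 (c • ![1, 0])) := by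
      rw [hψc]
      exact h.tendsto_atBot.const_smul c
    simpa using (congrFun (tendsto_nhds_unique h'.tendsto_atBot h1) 0).symm
  rw [hψc, hc1]
  simp

end IsJostMinus

/-! ### Existence of the Jost function -/

theorem hasDerivAt_integral_Iic {E : Type*} [NormedAddCommGroup E] [NormedSpace ℝ E]
    [CompleteSpace E] {g : ℝ → E} (hg : Continuous g)
    (hi : ∀ x, IntegrableOn g (Set.Iic x)) (x : ℝ) :
    HasDerivAt (fun y => ∫ z in Set.Iic y, g z) (g x) x := by
  have h : (fun y => ∫ z in Set.Iic y, g z) =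
      fun y => (∫ z in Set.Iic (0 : ℝ), g z) + ∫ z in (0 : ℝ)..y, g z := funext fun y => by
    rw [← intervalIntegral.integral_Iic_sub_Iic (hi 0) (hi y)]; abel
  rw [h]
  exact (intervalIntegral.integral_hasDerivAt_right (hg.intervalIntegrable _ _)
      (hg.stronglyMeasurableAtFilter _ _) hg.continuousAt).const_add _

theorem tendsto_integral_Iic_atBot {g : ℝ → ℝ} (hi : Integrable g) :
    Tendsto (fun y => ∫ z in Set.Iic y, g z) atBot (𝓝 0) := by
  have h1 := intervalIntegral_tendsto_integral_Iic (0 : ℝ) hi.integrableOn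
    (tendsto_id (α := ℝ) (x := atBot))
  have h2 := h1.const_sub (∫ z in Set.Iic (0 : ℝ), g z)
  rw [sub_self] at h2
  refine h2.congr fun y => ?_
  rw [id, ← intervalIntegral.integral_Iic_sub_Iic hi.integrableOn hi.integrableOn]
  ring

/-- The size of the perturbation in the equation for the Jost function. -/
noncomputable def jostSize (lam : ℂ) (u : ℝ → ℂ) (x : ℝ) : ℝ := ‖u x‖ ^ 2 / 4 + ‖lam‖ * ‖u x‖

/-- The exponential of twice the integrated size of the perturbation. -/
noncomputable def jostWeight (lam : ℂ) (u : ℝ → ℂ) (x : ℝ) : ℝ :=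
  Real.exp (2 * ∫ z in Set.Iic x, jostSize lam u z)

/-- The first component of the perturbation in the equation for the Jost function. -/
noncomputable def jostForceFst (lam : ℂ) (u : ℝ → ℂ) (φ : ℝ → Fin 2 → ℂ) (x : ℝ) : ℂ :=
  Complex.I / 4 * (u x * conj (u x)) * φ x 0 + lam * u x * φ x 1

/-- The second component of the perturbation in the equation for the Jost function. -/
noncomputable def jostForceSnd (lam : ℂ) (u : ℝ → ℂ) (φ : ℝ → Fin 2 → ℂ) (x : ℝ) : ℂ :=
  -(Complex.I / 4 * (u x * conj (u x))) * φ x 1 - lam * conj (u x) * φ x 0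

/-- The linear part of the Volterra equation for the Jost function. -/
noncomputable def jostVolterra (lam : ℂ) (u : ℝ → ℂ) (φ : ℝ → Fin 2 → ℂ) (x : ℝ) : Fin 2 → ℂ :=
  ![∫ y in Set.Iic x, jostForceFst lam u φ y,
    Complex.exp (2 * Complex.I * lam ^ 2 * x) *
      ∫ y in Set.Iic x, Complex.exp (-(2 * Complex.I * lam ^ 2 * y)) * jostForceSnd lam u φ y]

section Existence

open scoped BoundedContinuousFunction

variable {lam : ℂ} {q u : ℝ → ℂ} {φ ψ : ℝ → Fin 2 → ℂ}

theorem jostSize_nonneg (x : ℝ) : 0 ≤ jostSize lam u x := by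
  unfold jostSize; positivity

theorem continuous_jostSize (hu : Continuous u) : Continuous (jostSize lam u) := by
  unfold jostSize; fun_prop

theorem integrable_jostSize (h1 : Integrable u) (h2 : Integrable fun x => ‖u x‖ ^ 2) :
    Integrable (jostSize lam u) :=
  (h2.div_const 4).add (h1.norm.const_mul _)

theorem hasDerivAt_jostWeight (hu : Continuous u) (hh : Integrable (jostSize lam u)) (x : ℝ) :
    HasDerivAt (jostWeight lam u) (2 * (jostSize lam u x * jostWeight lam u x)) x := by
  have := ((hasDerivAt_integral_Iic (continuous_jostSize hu)
    (fun x => hh.integrableOn) x).const_mul 2).exp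
  convert! this using 1
  simp only [jostWeight]; ring

theorem continuous_jostWeight (hu : Continuous u) (hh : Integrable (jostSize lam u)) :
    Continuous (jostWeight lam u) :=
  continuous_iff_continuousAt.2 fun x => (hasDerivAt_jostWeight hu hh x).continuousAt

theorem jostWeight_pos (x : ℝ) : 0 < jostWeight lam u x := Real.exp_pos _

theorem one_le_jostWeight (x : ℝ) : 1 ≤ jostWeight lam u x :=
  Real.one_le_exp (mul_nonneg zero_le_two
    (setIntegral_nonneg measurableSet_Iic fun y _ => jostSize_nonneg y))

theorem jostWeight_le (hh : Integrable (jostSize lam u)) (x : ℝ) :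
    jostWeight lam u x ≤ Real.exp (2 * ∫ z, jostSize lam u z) := by
  refine Real.exp_le_exp.2 (mul_le_mul_of_nonneg_left ?_ zero_le_two)
  exact setIntegral_le_integral hh (ae_of_all _ jostSize_nonneg)

theorem integrable_jostSize_mul_jostWeight (hu : Continuous u)
    (hh : Integrable (jostSize lam u)) :
    Integrable fun x => jostSize lam u x * jostWeight lam u x := by
  refine hh.mul_bdd (c := Real.exp (2 * ∫ z, jostSize lam u z))
    (continuous_jostWeight hu hh).aestronglyMeasurable (ae_of_all _ fun x => ?_)
  rw [Real.norm_of_nonneg (jostWeight_pos x).le]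
  exact jostWeight_le hh x

theorem tendsto_jostWeight_atBot (hh : Integrable (jostSize lam u)) :
    Tendsto (jostWeight lam u) atBot (𝓝 1) := by
  have := (Real.continuous_exp.tendsto _).comp ((tendsto_integral_Iic_atBot hh).const_mul 2)
  simpa [Function.comp_def] using! this

/-- With $h$ the size and $W$ the weight, $W'=2hW$ and $W\to1$ at $-\infty$. The $2$ in the exponent
of $W$ is what produces the contraction factor $1/2$. -/
theorem integral_jostSize_mul_jostWeight (hu : Continuous u) (hh : Integrable (jostSize lam u))
    (x : ℝ) : ∫ y in Set.Iic x, jostSize lam u y * jostWeight lam u y =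
      (jostWeight lam u x - 1) / 2 := by
  have ht := tendsto_jostWeight_atBot hh
  have := integral_Iic_of_hasDerivAt_of_tendsto' (a := x)
    (fun y _ => hasDerivAt_jostWeight hu hh y)
    ((integrable_jostSize_mul_jostWeight hu hh).const_mul 2).integrableOn ht
  rw [integral_const_mul] at this
  linarith

theorem norm_jostForceFst_le (x : ℝ) :
    ‖jostForceFst lam u φ x‖ ≤ jostSize lam u x * ‖φ x‖ := by
  refine (norm_add_le _ _).trans ?_
  have h0 := norm_le_pi_norm (φ x) 0
  have h1 := norm_le_pi_norm (φ x) 1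
  simp only [norm_mul, norm_div, Complex.norm_I, RCLike.norm_conj, Complex.norm_ofNat]
  rw [jostSize, add_mul, show 1 / 4 * (‖u x‖ * ‖u x‖) = ‖u x‖ ^ 2 / 4 by ring]
  gcongr

theorem norm_jostForceSnd_le (x : ℝ) :
    ‖jostForceSnd lam u φ x‖ ≤ jostSize lam u x * ‖φ x‖ := by
  refine (norm_sub_le _ _).trans ?_
  have h0 := norm_le_pi_norm (φ x) 0
  have h1 := norm_le_pi_norm (φ x) 1
  simp only [norm_mul, norm_neg, norm_div, Complex.norm_I, RCLike.norm_conj, Complex.norm_ofNat]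
  rw [jostSize, add_mul, show 1 / 4 * (‖u x‖ * ‖u x‖) = ‖u x‖ ^ 2 / 4 by ring]
  gcongr

theorem continuous_jostForceFst (hu : Continuous u) (hφ : Continuous φ) :
    Continuous (jostForceFst lam u φ) := by
  have h0 : Continuous fun x => φ x 0 := (continuous_apply 0).comp hφ
  have h1 : Continuous fun x => φ x 1 := (continuous_apply 1).comp hφ
  unfold jostForceFst; fun_prop

theorem continuous_jostForceSnd (hu : Continuous u) (hφ : Continuous φ) :
    Continuous (jostForceSnd lam u φ) := by
  have h0 : Continuous fun x => φ x 0 := (continuous_apply 0).comp hφ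
  have h1 : Continuous fun x => φ x 1 := (continuous_apply 1).comp hφ
  unfold jostForceSnd; fun_prop

theorem norm_exp_two_I_mul (lam : ℂ) (x : ℝ) :
    ‖Complex.exp (2 * Complex.I * lam ^ 2 * x)‖ = Real.exp (-(2 * (lam ^ 2).im * x)) := by
  rw [Complex.norm_exp]
  congr 1
  rw [Complex.re_mul_ofReal, mul_assoc, show (2 : ℂ) = ((2 : ℝ) : ℂ) by simp,
    Complex.re_ofReal_mul]
  simp

theorem norm_exp_neg_two_I_mul (lam : ℂ) (x : ℝ) :
    ‖Complex.exp (-(2 * Complex.I * lam ^ 2 * x))‖ = Real.exp (2 * (lam ^ 2).im * x) := by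
  rw [Complex.exp_neg, norm_inv, norm_exp_two_I_mul, ← Real.exp_neg, neg_neg]

/-- The hypotheses under which the Volterra operator acts on `φ`, with the bound `D` of `φ` in the
weighted supremum norm. -/
structure JostAdmissible (lam : ℂ) (u : ℝ → ℂ) (φ : ℝ → Fin 2 → ℂ) (D : ℝ) : Prop where
  im_pos : 0 < (lam ^ 2).im
  continuous_u : Continuous u
  integrable_size : Integrable (jostSize lam u)
  continuous : Continuous φ
  bound : ∀ x, ‖φ x‖ ≤ D * jostWeight lam u x

namespace JostAdmissible

variable {D D' : ℝ}

theorem size_mul_norm_le (h : JostAdmissible lam u φ D) (x : ℝ) :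
    jostSize lam u x * ‖φ x‖ ≤ D * (jostSize lam u x * jostWeight lam u x) := by
  have := mul_le_mul_of_nonneg_left (h.bound x) (jostSize_nonneg (lam := lam) (u := u) x)
  linarith

theorem integrable_bound (h : JostAdmissible lam u φ D) :
    Integrable fun x => D * (jostSize lam u x * jostWeight lam u x) :=
  (integrable_jostSize_mul_jostWeight h.continuous_u h.integrable_size).const_mul D

theorem integrable_fst (h : JostAdmissible lam u φ D) : Integrable (jostForceFst lam u φ) :=
  h.integrable_bound.mono' (continuous_jostForceFst h.continuous_u h.continuous).aestronglyMeasurable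
    (ae_of_all _ fun x => (norm_jostForceFst_le x).trans (h.size_mul_norm_le x))

theorem integrable_snd (h : JostAdmissible lam u φ D) : Integrable (jostForceSnd lam u φ) :=
  h.integrable_bound.mono' (continuous_jostForceSnd h.continuous_u h.continuous).aestronglyMeasurable
    (ae_of_all _ fun x => (norm_jostForceSnd_le x).trans (h.size_mul_norm_le x))

theorem continuous_exp_mul_snd (h : JostAdmissible lam u φ D) : Continuous fun y : ℝ =>
    Complex.exp (-(2 * Complex.I * lam ^ 2 * y)) * jostForceSnd lam u φ y := by
  have := continuous_jostForceSnd (lam := lam) h.continuous_u h.continuous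
  fun_prop

/-- $|e^{-2i\lambda^2y}|=e^{2\operatorname{Im}(\lambda^2)y}$ is bounded on $(-\infty,x]$ but not on
the line, so integrability is claimed only on half-lines. -/
theorem integrableOn_exp_mul_snd (h : JostAdmissible lam u φ D) (x : ℝ) :
    IntegrableOn (fun y : ℝ =>
      Complex.exp (-(2 * Complex.I * lam ^ 2 * y)) * jostForceSnd lam u φ y) (Set.Iic x) := by
  refine Integrable.mono' (h.integrable_snd.norm.const_mul
    (Real.exp (2 * (lam ^ 2).im * x))).integrableOn
    h.continuous_exp_mul_snd.aestronglyMeasurable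
    (ae_restrict_of_forall_mem measurableSet_Iic fun y hy => ?_)
  rw [norm_mul, norm_exp_neg_two_I_mul]
  have := h.im_pos
  have hy : y ≤ x := hy
  gcongr

theorem hasDerivAt_volterra_zero (h : JostAdmissible lam u φ D) (x : ℝ) :
    HasDerivAt (fun x => jostVolterra lam u φ x 0) (jostForceFst lam u φ x) x :=
  hasDerivAt_integral_Iic (continuous_jostForceFst h.continuous_u h.continuous)
    (fun _ => h.integrable_fst.integrableOn) x

theorem hasDerivAt_volterra_one (h : JostAdmissible lam u φ D) (x : ℝ) :
    HasDerivAt (fun x => jostVolterra lam u φ x 1)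
      (2 * Complex.I * lam ^ 2 * jostVolterra lam u φ x 1 + jostForceSnd lam u φ x) x := by
  have h1 := hasDerivAt_integral_Iic h.continuous_exp_mul_snd h.integrableOn_exp_mul_snd x
  have h2 : HasDerivAt (fun x : ℝ => Complex.exp (2 * Complex.I * lam ^ 2 * x))
      (Complex.exp (2 * Complex.I * lam ^ 2 * x) * (2 * Complex.I * lam ^ 2 * 1)) x :=
    ((Complex.ofRealCLM.hasDerivAt (x := x)).const_mul (2 * Complex.I * lam ^ 2)).cexp
  convert! h2.mul h1 using 1
  simp only [jostVolterra, Matrix.cons_val_one, Matrix.cons_val_fin_one]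
  rw [← mul_assoc (Complex.exp _) (Complex.exp _), ← Complex.exp_add, add_neg_cancel,
    Complex.exp_zero]
  ring

theorem continuous_volterra (h : JostAdmissible lam u φ D) :
    Continuous (jostVolterra lam u φ) := by
  refine continuous_pi fun i => continuous_iff_continuousAt.2 fun x => ?_
  fin_cases i
  · exact (h.hasDerivAt_volterra_zero x).continuousAt
  · exact (h.hasDerivAt_volterra_one x).continuousAt

/-- Since $\operatorname{Im}\lambda^2>0$, the kernel $e^{2i\lambda^2(x-y)}$ has modulus at most $1$
for $y\le x$, so both components are dominated by the integral of size times weight. -/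
theorem norm_volterra_le (h : JostAdmissible lam u φ D) (x : ℝ) :
    ‖jostVolterra lam u φ x‖ ≤ D * ((jostWeight lam u x - 1) / 2) := by
  have hI : ∫ y in Set.Iic x, D * (jostSize lam u y * jostWeight lam u y) =
      D * ((jostWeight lam u x - 1) / 2) := by
    rw [integral_const_mul, integral_jostSize_mul_jostWeight h.continuous_u h.integrable_size]
  have h0 : ‖jostVolterra lam u φ x 0‖ ≤ D * ((jostWeight lam u x - 1) / 2) := by
    rw [← hI]
    exact norm_integral_le_of_norm_le h.integrable_bound.integrableOn
      (ae_of_all _ fun y => (norm_jostForceFst_le y).trans (h.size_mul_norm_le y))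
  have h1 : ‖jostVolterra lam u φ x 1‖ ≤ D * ((jostWeight lam u x - 1) / 2) := by
    rw [← hI]
    simp only [jostVolterra, Matrix.cons_val_one, Matrix.cons_val_fin_one]
    rw [← integral_const_mul]
    refine norm_integral_le_of_norm_le h.integrable_bound.integrableOn
      (ae_restrict_of_forall_mem measurableSet_Iic fun y hy => ?_)
    rw [norm_mul, norm_mul, norm_exp_two_I_mul, norm_exp_neg_two_I_mul, ← mul_assoc,
      ← Real.exp_add]
    refine le_trans (mul_le_of_le_one_left (norm_nonneg _) (Real.exp_le_one_iff.2 ?_))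
      ((norm_jostForceSnd_le y).trans (h.size_mul_norm_le y))
    have hy : y ≤ x := hy
    nlinarith [h.im_pos]
  refine (pi_norm_le_iff_of_nonneg ((norm_nonneg _).trans h0)).2 fun i => ?_
  fin_cases i
  · exact h0
  · exact h1

theorem sub (h : JostAdmissible lam u φ D) (h' : JostAdmissible lam u ψ D') {C : ℝ}
    (hC : ∀ x, ‖φ x - ψ x‖ ≤ C * jostWeight lam u x) :
    JostAdmissible lam u (fun x => φ x - ψ x) C :=
  ⟨h.im_pos, h.continuous_u, h.integrable_size, h.continuous.sub h'.continuous, hC⟩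

theorem volterra_sub (h : JostAdmissible lam u φ D) (h' : JostAdmissible lam u ψ D') (x : ℝ) :
    jostVolterra lam u φ x - jostVolterra lam u ψ x =
      jostVolterra lam u (fun x => φ x - ψ x) x := by
  have e0 : ∀ y, jostForceFst lam u (fun x => φ x - ψ x) y =
      jostForceFst lam u φ y - jostForceFst lam u ψ y := fun y => by
    simp only [jostForceFst, Pi.sub_apply]; ring
  have e1 : ∀ y : ℝ, Complex.exp (-(2 * Complex.I * lam ^ 2 * y)) *
      jostForceSnd lam u (fun x => φ x - ψ x) y =
      Complex.exp (-(2 * Complex.I * lam ^ 2 * y)) * jostForceSnd lam u φ y -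
      Complex.exp (-(2 * Complex.I * lam ^ 2 * y)) * jostForceSnd lam u ψ y := fun y => by
    simp only [jostForceSnd, Pi.sub_apply]; ring
  ext i
  fin_cases i
  · simp only [jostVolterra, e0]
    exact (integral_sub h.integrable_fst.integrableOn h'.integrable_fst.integrableOn).symm
  · simp only [jostVolterra, e1, integral_sub (h.integrableOn_exp_mul_snd x)
      (h'.integrableOn_exp_mul_snd x)]
    simp [mul_sub]

/-- A fixed point of the Volterra equation is a Jost function. -/
theorem isJostMinus (h : JostAdmissible lam u φ D) (hqu : q =ᵐ[volume] u)
    (hfix : ∀ x, φ x = ![1, 0] + jostVolterra lam u φ x) : IsJostMinus q lam φ := by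
  have hD : 0 ≤ D := by
    have := (norm_nonneg _).trans (h.bound 0)
    exact nonneg_of_mul_nonneg_left this (jostWeight_pos 0)
  refine ⟨solvesSpectralProblem_of_hasDerivAt hqu h.continuous_u fun x => ?_, ?_, ?_⟩
  · have hf : φ = fun x => ![1, 0] + jostVolterra lam u φ x := funext hfix
    have d0 : HasDerivAt (fun x => φ x 0) (jostForceFst lam u φ x) x := by
      have := (h.hasDerivAt_volterra_zero x).const_add 1
      convert! this using 1
      funext y
      rw [hfix y]; rfl
    have d1 : HasDerivAt (fun x => φ x 1)
        (2 * Complex.I * lam ^ 2 * φ x 1 + jostForceSnd lam u φ x) x := by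
      have e : ∀ y, φ y 1 = jostVolterra lam u φ y 1 := fun y => by
        conv_lhs => rw [hfix y]
        simp
      simp only [e]
      exact h.hasDerivAt_volterra_one x
    have h2 : HasDerivAt (fun x : ℝ => Complex.exp (-Complex.I * lam ^ 2 * x))
        (Complex.exp (-Complex.I * lam ^ 2 * x) * (-Complex.I * lam ^ 2 * 1)) x :=
      ((Complex.ofRealCLM.hasDerivAt (x := x)).const_mul (-Complex.I * lam ^ 2)).cexp
    refine hasDerivAt_pi.2 fun i => ?_
    fin_cases i
    · convert! h2.mul d0 using 1
      simp only [Fin.zero_eta, laxU_mulVec_zero, seedSolution, Pi.smul_apply, smul_eq_mul,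
        jostForceFst]
      ring
    · convert! h2.mul d1 using 1
      simp only [Fin.mk_one, laxU_mulVec_one, seedSolution, Pi.smul_apply, smul_eq_mul,
        jostForceSnd]
      ring
  · refine ⟨D * Real.exp (2 * ∫ z, jostSize lam u z), fun x => (h.bound x).trans ?_⟩
    exact mul_le_mul_of_nonneg_left (jostWeight_le h.integrable_size x) hD
  · rw [tendsto_iff_norm_sub_tendsto_zero]
    have ht : Tendsto (jostWeight lam u) atBot (𝓝 1) :=
      tendsto_jostWeight_atBot h.integrable_size
    refine squeeze_zero (fun x => norm_nonneg _) (g := fun x =>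
      D * ((jostWeight lam u x - 1) / 2)) (fun x => ?_) ?_
    · rw [hfix x, add_sub_cancel_left]
      exact h.norm_volterra_le x
    · simpa using ((ht.sub_const 1).div_const 2).const_mul D

end JostAdmissible

/-- Dividing by the weight turns the weighted supremum norm into the ordinary one, so Banach's
theorem applies on bounded continuous functions without any smallness of $u$. -/
theorem exists_isJostMinus (hlam : 0 < (lam ^ 2).im) (hqu : q =ᵐ[volume] u) (hu : Continuous u)
    (hh : Integrable (jostSize lam u)) : ∃ φ, IsJostMinus q lam φ := by
  have hE := continuous_jostWeight hu hh
  have hadm : ∀ ψ : ℝ →ᵇ (Fin 2 → ℂ),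
      JostAdmissible lam u (fun x => jostWeight lam u x • ψ x) ‖ψ‖ := fun ψ =>
    ⟨hlam, hu, hh, hE.smul ψ.continuous, fun x => by
      rw [norm_smul, Real.norm_of_nonneg (jostWeight_pos x).le, mul_comm]
      exact mul_le_mul_of_nonneg_right (ψ.norm_coe_le_norm x) (jostWeight_pos x).le⟩
  -- The Volterra map conjugated by the weight $W$, acting on $\psi=\varphi/W$; its Lipschitz
  -- constant is $1/2$ because $(W-1)/2\le W/2$.
  let f : (ℝ →ᵇ (Fin 2 → ℂ)) → ℝ → Fin 2 → ℂ := fun ψ x =>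
    (jostWeight lam u x)⁻¹ • (![1, 0] + jostVolterra lam u (fun x => jostWeight lam u x • ψ x) x)
  have hscale : ∀ {v : Fin 2 → ℂ} {C x : ℝ}, ‖v‖ ≤ C * jostWeight lam u x →
      ‖(jostWeight lam u x)⁻¹ • v‖ ≤ C := fun {v C x} hv => by
    rw [norm_smul, norm_inv, Real.norm_of_nonneg (jostWeight_pos x).le,
      inv_mul_le_iff₀ (jostWeight_pos x), mul_comm]
    exact hv
  have hfc : ∀ ψ, Continuous (f ψ) := fun ψ =>
    (hE.inv₀ fun x => (jostWeight_pos x).ne').smul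
      (continuous_const.add (hadm ψ).continuous_volterra)
  have hfb : ∀ ψ x, ‖f ψ x‖ ≤ 1 + ‖ψ‖ := fun ψ x => hscale (by
    have h1 : ‖(![1, 0] : Fin 2 → ℂ)‖ ≤ 1 :=
      (pi_norm_le_iff_of_nonneg zero_le_one).2 fun i => by fin_cases i <;> simp
    have h2 := (hadm ψ).norm_volterra_le x
    have h3 := one_le_jostWeight (lam := lam) (u := u) x
    have h4 := norm_nonneg ψ
    refine (norm_add_le _ _).trans ?_
    nlinarith)
  let T : (ℝ →ᵇ (Fin 2 → ℂ)) → (ℝ →ᵇ (Fin 2 → ℂ)) := fun ψ =>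
    BoundedContinuousFunction.ofNormedAddCommGroup (f ψ) (hfc ψ) (1 + ‖ψ‖) (hfb ψ)
  have hT : ContractingWith (1 / 2) T := by
    refine ⟨by rw [← NNReal.coe_lt_coe]; norm_num, LipschitzWith.of_dist_le_mul fun ψ χ => ?_⟩
    rw [dist_eq_norm, dist_eq_norm]
    refine (BoundedContinuousFunction.norm_le (by positivity)).2 fun x => ?_
    have e1 : (T ψ - T χ) x = (jostWeight lam u x)⁻¹ •
        jostVolterra lam u (fun x => jostWeight lam u x • ψ x - jostWeight lam u x • χ x) x := by
      rw [← (hadm ψ).volterra_sub (hadm χ)]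
      change f ψ x - f χ x = _
      simp only [f]
      rw [← smul_sub, add_sub_add_left_eq_sub]
    rw [e1]
    refine hscale ?_
    have hd := (hadm ψ).sub (hadm χ) (C := ‖ψ - χ‖) fun x => by
      rw [← smul_sub, norm_smul, Real.norm_of_nonneg (jostWeight_pos x).le, mul_comm]
      exact mul_le_mul_of_nonneg_right ((ψ - χ).norm_coe_le_norm x) (jostWeight_pos x).le
    refine (hd.norm_volterra_le x).trans ?_
    push_cast
    nlinarith [norm_nonneg (ψ - χ)]
  let ψ := ContractingWith.fixedPoint T hT
  have hψ : T ψ = ψ := hT.fixedPoint_isFixedPt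
  refine ⟨_, (hadm ψ).isJostMinus hqu fun x => ?_⟩
  have h1 : f ψ x = ψ x := DFunLike.congr_fun hψ x
  rw [← h1]
  simp only [f]
  rw [smul_smul, mul_inv_cancel₀ (jostWeight_pos x).ne', one_smul]

end Existence

/-! ### The proposition -/

/-- For `q ∈ H²(ℝ) ∩ H^{1,1}(ℝ)` and `Im λ₁² > 0`, the Jost function `φ₋(·; λ₁)` exists and is
unique, and with `Φ₁ = φ₋ e^{-iλ₁²x}` the denominator `m_{λ₁}(Φ₁, Φ₁)` never vanishes and
`q⁽¹⁾ = B(Φ₁; λ₁) q ∈ H²(ℝ) ∩ H^{1,1}(ℝ)`; whether `a(λ₁)` vanishes plays no role. -/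
theorem proposition4p6 (q : ℝ → ℂ) (hq2 : MemSobolevH 2 q) (hq11 : MemSobolevHWeighted 1 1 q)
    (lam₁ : ℂ) (hlam₁ : 0 < (lam₁ ^ 2).im) :
    (∃! φ : ℝ → Fin 2 → ℂ, IsJostMinus q lam₁ φ) ∧
    ∀ φ : ℝ → Fin 2 → ℂ, IsJostMinus q lam₁ φ →
      (∀ x : ℝ, mForm lam₁ (seedSolution lam₁ φ x) (seedSolution lam₁ φ x) ≠ 0) ∧
      MemSobolevH 2 (darbouxB lam₁ (seedSolution lam₁ φ) q) ∧
      MemSobolevHWeighted 1 1 (darbouxB lam₁ (seedSolution lam₁ φ) q) := by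
  -- All analysis is done for the $C^1$ representative $u$. Solutions depend only on the class of
  -- $q$, and the transform is pointwise in $q$, so the conclusions pass back almost everywhere.
  obtain ⟨u, u₁, u₂, hu, hqu⟩ := hq2.exists_sobolevRep hq11
  have hc := hu.isPrimitive.continuous
  have hb := hu.bounded
  refine ⟨?_, fun φ hφ => ?_⟩
  · obtain ⟨φ, hφ⟩ := exists_isJostMinus hlam₁ hqu hc
      (integrable_jostSize hu.weighted.integrable hu.weighted.integrable_sq)
    exact ⟨φ, hφ, fun ψ hψ => hψ.unique hlam₁ hφ hqu hc hb⟩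
  · have h0 := hφ.ne_zero hqu hc hb
    obtain ⟨v₁, v₂, hv⟩ := hu.darbouxB hlam₁ (hφ.hasDerivAt hqu hc) h0
    have hae : darbouxB lam₁ (seedSolution lam₁ φ) u =ᵐ[volume]
        darbouxB lam₁ (seedSolution lam₁ φ) q :=
      hqu.mono fun x hx => by simp only [darbouxB, hx]
    exact ⟨fun x => mForm_ne_zero (ne_zero_re_of_im_sq_pos hlam₁) (h0 x), hv.memSobolevH hae,
      hv.memSobolevHWeighted hae⟩
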